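/- Let $m\ge 1$, let $\mathbf A$ be a real $m\times n$ matrix, $\mathbf b\in\mathbb R^m$, and let $f:\mathbb R^n\to\mathbb R$ be twice continuously differentiable and strongly convex. Consider the program $\min f(\mathbf x)$ subject to $\mathbf A\mathbf x\le\mathbf b$, with constraint functions $g_k(\mathbf x)=(\mathbf A\mathbf x)_k-b_k$, and assume that it has an optimal solution $\mathbf x^\ast$. Let $q(\boldsymbol\lambda)=\min_{\mathbf x\in\mathbb R^n}\{f(\mathbf x)+\sum_k\lambda_kg_k(\mathbf x)\}$, $\boldsymbol\lambda\in\mathbb R^m_+$, be the dual function. Consider the following conditions (norms are Euclidean). (A1) $f$ is strongly convex with some modulus $\alpha>0$, and every $g_k$ is Lipschitz with some modulus $\beta>0$. (A2) There is a Lagrange multiplier, i.e. a $\boldsymbol\lambda^\ast\in\mathbb R^m_+$ with $q(\boldsymbol\lambda^\ast)=\min\{f(\mathbf x):\mathbf A\mathbf x\le\mathbf b\}$. (A3) $q$ is differentiable on $\mathbb R^m_+$, with a gradient that is Lipschitz on $\mathbb R^m_+$ with some modulus $\gamma>0$. (A4) For every Lagrange multiplier $\boldsymbol\lambda^\ast$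 there are $D_q,L_q>0$ with $q(\boldsymbol\lambda^\ast)\ge q(\boldsymbol\lambda)+L_q\|\boldsymbol\lambda-\boldsymbol\lambda^\ast\|^2$ for all $\boldsymbol\lambda\in\mathbb R^m_+$ with $\|\boldsymbol\lambda-\boldsymbol\lambda^\ast\|\le D_q$. (A5) For every Lagrange multiplier $\boldsymbol\lambda^\ast$ there are $D_c,L_c>0$ such that $q$ is strongly concave with modulus $L_c$ on $\{\boldsymbol\lambda\in\mathbb R^m_+:\|\boldsymbol\lambda-\boldsymbol\lambda^\ast\|\le D_c\}$. The drift-plus-penalty algorithm with parameter $V>0$ and initial values $Q_k(0)\ge0$ computes, for $t=0,1,2,\dots$, $$\mathbf x(t)=\operatorname*{argmin}_{\mathbf x\in\mathbb R^n}\Big[Vf(\mathbf x)+\sum_{k}Q_k(t)g_k(\mathbf x)\Big],\qquad Q_k(t+1)=\max\{Q_k(t)+g_k(\mathbf x(t)),0\};$$ its shifted running averages are $\overline{\mathbf x}(t)=\frac{2}{t}\sum_{\tau=t/2}^{t-1}\mathbf x(\tau)$ for even $t\ge2$ and $\overline{\mathbf x}(t)=\overline{\mathbf x}(t-1)$ for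 odd $t$, where $\overline{\mathbf x}(0)$ is arbitrary. A sequence $\mathbf y(t)$ has error decaying like $O(r(t))$ if for some constant $C$ and all large $t$ one has $f(\mathbf y(t))\le f(\mathbf x^\ast)+Cr(t)$ and $g_k(\mathbf y(t))\le Cr(t)$ for all $k$; it has convergence time $O(h(\epsilon))$ if for some constant $C$ and all sufficiently small $\epsilon>0$, every $\mathbf y(t)$ with $t\ge Ch(\epsilon)$ is $\epsilon$-optimal, i.e. $f(\mathbf y(t))\le f(\mathbf x^\ast)+\epsilon$ and $g_k(\mathbf y(t))\le\epsilon$ for all $k$. Then the minimum defining $q(\boldsymbol\lambda)$ is attained for every $\boldsymbol\lambda\in\mathbb R^m_+$, the algorithm can be executed for all $V>0$ and $\mathbf Q(0)\ge\mathbf 0$, and the following hold. 1. Let $l$ be the number of constraints active at $\mathbf x^\ast$ and $\mathbf A'$ the $l\times n$ submatrix of the corresponding rows of $\mathbf A$. If $\operatorname{rank}(\mathbf A')=l$, then (A1)–(A4) hold. Moreover, for all moduli $\alpha,\beta,\gamma$ as in (A1) and (A3), all $V\ge\max\{m\beta^2/\alpha,\gamma\}$ and all $\mathbf Q(0)\ge\mathbf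 0$, the shifted running averages $\overline{\mathbf x}(t)$ have error decaying like $O(1/t^{3/2})$ and convergence time $O(1/\epsilon^{2/3})$. 2. If $\operatorname{rank}(\mathbf A)=m$, then (A1)–(A3) and (A5) hold. Moreover, for all moduli $\alpha,\beta,\gamma$ as in (A1) and (A3), all $V\ge\max\{m\beta^2/\alpha,\gamma\}$ and all $\mathbf Q(0)\ge\mathbf 0$, both the iterates $\mathbf x(t)$ themselves and the shifted running averages $\overline{\mathbf x}(t)$ have error decaying like $O\big(\frac1t(1-\frac{L_c}{V})^{t/4}\big)$, for every $L_c$ as in (A5), and convergence time $O(\log(1/\epsilon))$. -/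

import Mathlib

namespace DPP

open Set Filter Topology
open scoped Matrix

/-- `ℝ^d` with the Euclidean norm. -/
abbrev E (d : ℕ) : Type := EuclideanSpace ℝ (Fin d)

/-- The nonnegative orthant `ℝ^d_+`. -/
def orthant (d : ℕ) : Set (E d) := {v | ∀ k, 0 ≤ v k}

/-! ### The program `min f(x)` subject to `g_k(x) ≤ 0` for all `k`, `x ∈ X` -/

/-- The feasible set. -/
def feasible {m n : ℕ} (X : Set (E n)) (g : Fin m → E n → ℝ) : Set (E n) :=
  {x | x ∈ X ∧ ∀ k, g k x ≤ 0}

/-- `x` is an optimal solution of the program. -/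
def IsOptimal {m n : ℕ} (X : Set (E n)) (f : E n → ℝ) (g : Fin m → E n → ℝ) (x : E n) : Prop :=
  x ∈ feasible X g ∧ IsMinOn f (feasible X g) x

/-- `x` is an `ε`-optimal solution, where `xs` is an optimal solution. -/
def IsEpsOptimal {m n : ℕ} (X : Set (E n)) (f : E n → ℝ) (g : Fin m → E n → ℝ) (xs : E n)
    (ε : ℝ) (x : E n) : Prop :=
  x ∈ X ∧ f x ≤ f xs + ε ∧ ∀ k, g k x ≤ ε

/-- The Lagrangian `f(x) + ∑ λ_k g_k(x)`. -/
def lagrangian {m n : ℕ} (f : E n → ℝ) (g : Fin m → E n → ℝ) (lam : E m) (x : E n) : ℝ :=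
  f x + ∑ k, lam k * g k x

/-- The Lagrangian dual function `q(λ)`, the minimum of the Lagrangian over `X`. -/
noncomputable def dual {m n : ℕ} (X : Set (E n)) (f : E n → ℝ) (g : Fin m → E n → ℝ)
    (lam : E m) : ℝ :=
  sInf (lagrangian f g lam '' X)

/-- The minimum that defines the dual function is attained for every `λ ∈ ℝ^m_+`. -/
def DualAttained {m n : ℕ} (X : Set (E n)) (f : E n → ℝ) (g : Fin m → E n → ℝ) : Prop :=
  ∀ lam ∈ orthant m, IsLeast (lagrangian f g lam '' X) (dual X f g lam)

/-- `λ ≥ 0` is a Lagrange multiplier attaining strong duality: `q(λ)` is the optimal value. -/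
def IsLagrangeMultiplier {m n : ℕ} (X : Set (E n)) (f : E n → ℝ) (g : Fin m → E n → ℝ)
    (lam : E m) : Prop :=
  lam ∈ orthant m ∧ IsLeast (f '' feasible X g) (dual X f g lam)

/-! ### The assumptions on the program -/

/-- `f` is strongly convex on `X` with modulus `α > 0` and every `g_k` is Lipschitz continuous on
`X` with modulus `β > 0`. -/
def StronglyConvexProblem {m n : ℕ} (X : Set (E n)) (f : E n → ℝ) (g : Fin m → E n → ℝ)
    (α β : ℝ) : Prop :=
  0 < α ∧ StrongConvexOn X α f ∧
    0 < β ∧ ∀ k, ∀ x ∈ X, ∀ y ∈ X, |g k y - g k x| ≤ β * ‖y - x‖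

/-- Strong duality holds. -/
def StrongDuality {m n : ℕ} (X : Set (E n)) (f : E n → ℝ) (g : Fin m → E n → ℝ) : Prop :=
  ∃ lam, IsLagrangeMultiplier X f g lam

/-- `F` is differentiable on `S` with a gradient that is Lipschitz continuous on `S` with modulus
`L > 0` (so `F` is continuously differentiable on `S`). The gradient is taken relative to `S`, so
that it makes sense at the boundary points of the orthant; it is unique there. -/
def IsSmoothOn {d : ℕ} (S : Set (E d)) (F : E d → ℝ) (L : ℝ) : Prop :=
  0 < L ∧ ∃ G : E d → E d, (∀ x ∈ S, HasGradientWithinAt F (G x) S x) ∧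
    ∀ x ∈ S, ∀ y ∈ S, ‖G y - G x‖ ≤ L * ‖y - x‖

/-- The dual function is smooth on `ℝ^m_+` with modulus `γ`. -/
def SmoothDual {m n : ℕ} (X : Set (E n)) (f : E n → ℝ) (g : Fin m → E n → ℝ) (γ : ℝ) : Prop :=
  IsSmoothOn (orthant m) (dual X f g) γ

/-- The dual function is locally quadratic at `lams`, with radius `D > 0` and constant `L > 0`. -/
def LocallyQuadraticDualAt {m n : ℕ} (X : Set (E n)) (f : E n → ℝ) (g : Fin m → E n → ℝ)
    (lams : E m) (D L : ℝ) : Prop :=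
  0 < D ∧ 0 < L ∧ ∀ lam ∈ orthant m, ‖lam - lams‖ ≤ D →
    dual X f g lam + L * ‖lam - lams‖ ^ 2 ≤ dual X f g lams

/-- The dual function is strongly concave with modulus `L > 0` on the part of the orthant within
distance `D > 0` of `lams`. -/
def LocallyStronglyConcaveDualAt {m n : ℕ} (X : Set (E n)) (f : E n → ℝ) (g : Fin m → E n → ℝ)
    (lams : E m) (D L : ℝ) : Prop :=
  0 < D ∧ 0 < L ∧
    StrongConcaveOn {lam | lam ∈ orthant m ∧ ‖lam - lams‖ ≤ D} L (dual X f g)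

/-! ### The algorithm -/

/-- A run of the drift-plus-penalty algorithm with shifted running averages with parameter `V`:
`x t` are the primal iterates, `Q t` the virtual queues, and `xbar t` the shifted running averages
(the value `xbar 0` is arbitrary). The pair `x`, `Q` alone is a run of the drift-plus-penalty
algorithm without running averages. -/
structure IsRun {m n : ℕ} (X : Set (E n)) (f : E n → ℝ) (g : Fin m → E n → ℝ) (V : ℝ)
    (x : ℕ → E n) (Q : ℕ → E m) (xbar : ℕ → E n) : Prop where
  V_pos : 0 < V
  init : Q 0 ∈ orthant m
  mem : ∀ t, x t ∈ X
  argmin : ∀ t, IsMinOn (fun y => V * f y + ∑ k, Q t k * g k y) X (x t)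
  queue : ∀ t k, Q (t + 1) k = max (Q t k + g k (x t)) 0
  avg_even : ∀ t, Even (t + 1) →
    xbar (t + 1) = (((t + 1 : ℕ) : ℝ) / 2)⁻¹ • ∑ τ ∈ Finset.Icc ((t + 1) / 2) t, x τ
  avg_odd : ∀ t, Odd (t + 1) → xbar (t + 1) = xbar t

/-- The algorithm can be executed with every parameter `V > 0` and all initial queues. -/
def RunsExist {m n : ℕ} (X : Set (E n)) (f : E n → ℝ) (g : Fin m → E n → ℝ) : Prop :=
  ∀ V : ℝ, 0 < V → ∀ Q₀ ∈ orthant m, ∃ x Q xbar, IsRun X f g V x Q xbar ∧ Q 0 = Q₀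

/-- The objective and constraint errors of the sequence `y` decay like `O(r(t))`. -/
def ErrorDecaysLike {m n : ℕ} (f : E n → ℝ) (g : Fin m → E n → ℝ) (xs : E n) (y : ℕ → E n)
    (r : ℕ → ℝ) : Prop :=
  ∃ C : ℝ, 0 < C ∧ ∀ᶠ t : ℕ in atTop, f (y t) ≤ f xs + C * r t ∧ ∀ k, g k (y t) ≤ C * r t

/-- The convergence time of the sequence `y` is `O(h(ε))` as `ε → 0`: there is a constant `C`
such that, for all small `ε > 0`, every `y t` with `t ≥ C h(ε)` is `ε`-optimal. -/
def HasConvergenceTime {m n : ℕ} (X : Set (E n)) (f : E n → ℝ) (g : Fin m → E n → ℝ) (xs : E n)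
    (y : ℕ → E n) (h : ℝ → ℝ) : Prop :=
  ∃ C : ℝ, 0 < C ∧ ∀ᶠ ε : ℝ in 𝓝[>] 0, ∀ t : ℕ, C * h ε ≤ t → IsEpsOptimal X f g xs ε (y t)

/-! ### Linear constraints `A x ≤ b` -/

/-- The constraint functions `g_k(x) = (A x)_k - b_k`. -/
def linCon {m n : ℕ} (A : Matrix (Fin m) (Fin n) ℝ) (b : Fin m → ℝ) (k : Fin m) (x : E n) : ℝ :=
  (A *ᵥ x.ofLp) k - b k

/-- The constraints that are active at `x`. -/
def activeSet {m n : ℕ} (A : Matrix (Fin m) (Fin n) ℝ) (b : Fin m → ℝ) (x : E n) :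
    Set (Fin m) :=
  {k | (A *ᵥ x.ofLp) k = b k}

/-- The submatrix of the rows of `A` whose constraints are active at `x`. -/
def activeSubmatrix {m n : ℕ} (A : Matrix (Fin m) (Fin n) ℝ) (b : Fin m → ℝ) (x : E n) :
    Matrix (activeSet A b x) (Fin n) ℝ :=
  A.submatrix (fun k => (k : Fin m)) id

end DPP

/-!
The scaled queues `λ_t = Q(t) / V` perform projected gradient ascent with step size `1 / V` on the
dual function `q`, whose gradient at `λ` is the constraint vector at the minimizer of the
Lagrangian. Strong convexity of `f` and the Lipschitz constraints make this gradient cocoercive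
with constant `mβ² / α ≤ V`. Each step therefore gains `‖λ_{t+1} - λ*‖² + (2 / V)(q(λ*) -
q(λ_{t+1})) ≤ ‖λ_t - λ*‖²`, so quadratic decay of `q` at `λ*` gives linear convergence, and strong
concavity gives the contraction factor `1 - L_c / V` for `‖λ_t - λ*‖²`. The primal errors at time
`t` are bounded by a multiple of `‖λ_t - λ*‖`; those of the averages follow by convexity.

The rank conditions enter through `∇f(x) = -Aᵀλ` at a minimizer `x` of the Lagrangian: independent
rows make `λ` (on the active coordinates) a Lipschitz function of `x`, so the growth
`(α / 2)‖x - x*‖²` of the Lagrangian becomes quadratic decay of `q`. On the inactive coordinates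
`λ* = 0` and `q` decays even linearly, by the slack of the constraints.
-/

namespace DPP

open Set Filter Topology
open scoped Matrix RealInnerProductSpace

/-! ### Strong convexity -/

theorem le_of_forall_one_sub_mul_le {a c : ℝ} (h : ∀ s ∈ Ioo (0 : ℝ) 1, (1 - s) * a ≤ c) :
    a ≤ c := by
  have hlim : Tendsto (fun s : ℝ => (1 - s) * a) (𝓝[>] 0) (𝓝 ((1 - 0) * a)) :=
    (Continuous.tendsto (by fun_prop) 0).mono_left nhdsWithin_le_nhds
  rw [sub_zero, one_mul] at hlim
  exact le_of_tendsto hlim (eventually_of_mem (Ioo_mem_nhdsGT one_pos) h)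

section StrongConvexity

variable {F : Type*} [NormedAddCommGroup F] [NormedSpace ℝ F] {s : Set F} {h : F → ℝ} {α : ℝ}

theorem strongConvexOn_add_convexOn {k : F → ℝ} (hc : StrongConvexOn s α h)
    (hk : ConvexOn ℝ s k) : StrongConvexOn s α fun x => h x + k x :=
  (UniformConvexOn.add hc (strongConvexOn_zero.2 hk)).mono fun r => by simp

theorem add_sq_le_of_isMinOn {x y : F} (hc : StrongConvexOn s α h) (hy : y ∈ s)
    (hmin : IsMinOn h s y) (hx : x ∈ s) : h y + α / 2 * ‖x - y‖ ^ 2 ≤ h x := by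
  suffices hs : α / 2 * ‖x - y‖ ^ 2 ≤ h x - h y by linarith
  refine le_of_forall_one_sub_mul_le fun t ht => ?_
  have hle := hc.2 hy hx (sub_nonneg.2 ht.2.le) ht.1.le (sub_add_cancel 1 t)
  have hmin' := isMinOn_iff.1 hmin _ (hc.1 hy hx (sub_nonneg.2 ht.2.le) ht.1.le (by ring))
  rw [norm_sub_rev y x] at hle
  simp only [smul_eq_mul] at hle
  exact le_of_mul_le_mul_left (by linarith) ht.1

theorem add_mul_le_of_one_le_norm_sub {M : ℝ} {x y : F} (hc : StrongConvexOn s α h) (hx : x ∈ s)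
    (hy : y ∈ s) (hM : ∀ z ∈ Metric.closedBall x 1 ∩ s, M ≤ h z) (hxy : 1 ≤ ‖y - x‖) :
    h x + ‖y - x‖ * (α / 2 * (‖y - x‖ - 1) - (h x - M)) ≤ h y := by
  set r := ‖y - x‖
  have hr : 0 < r := one_pos.trans_le hxy
  have hr1 : r⁻¹ ≤ 1 := inv_le_one_of_one_le₀ hxy
  have hz : (1 - r⁻¹) • x + r⁻¹ • y = x + r⁻¹ • (y - x) := by module
  have hball : x + r⁻¹ • (y - x) ∈ Metric.closedBall x 1 := by
    simp [norm_smul, r, inv_mul_cancel₀ hr.ne']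
  have hmem : x + r⁻¹ • (y - x) ∈ s :=
    hz ▸ hc.1 hx hy (sub_nonneg.2 hr1) (by positivity) (by ring)
  have hle := hc.2 hx hy (sub_nonneg.2 hr1) (by positivity : 0 ≤ r⁻¹) (by ring)
  rw [hz, norm_sub_rev x y] at hle
  have hle' := mul_le_mul_of_nonneg_left ((hM _ ⟨hball, hmem⟩).trans hle) hr.le
  have hexpand : r * ((1 - r⁻¹) • h x + r⁻¹ • h y - (1 - r⁻¹) * r⁻¹ * (α / 2 * r ^ 2)) =
      (r - 1) * h x + h y - r * (α / 2 * (r - 1)) := by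
    simp only [smul_eq_mul]
    field_simp
  change r * M ≤ r * ((1 - r⁻¹) • h x + r⁻¹ • h y - (1 - r⁻¹) * r⁻¹ * (α / 2 * r ^ 2)) at hle'
  linarith

theorem exists_isMinOn_of_strongConvexOn [ProperSpace F] (hα : 0 < α) (hc : StrongConvexOn s α h)
    (hs : IsClosed s) (hne : s.Nonempty) (hcont : ContinuousOn h s) :
    ∃ x ∈ s, IsMinOn h s x := by
  obtain ⟨x, hx⟩ := hne
  obtain ⟨z, -, hz⟩ := ((isCompact_closedBall x 1).inter_right hs).exists_isMinOn
    ⟨x, Metric.mem_closedBall_self zero_le_one, hx⟩ (hcont.mono inter_subset_right)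
  have hzx : h z ≤ h x := hz ⟨Metric.mem_closedBall_self zero_le_one, hx⟩
  refine hcont.exists_isMinOn' hs hx ?_
  rw [eventually_inf_principal]
  filter_upwards [(isCompact_closedBall x (1 + 2 * (h x - h z) / α)).compl_mem_cocompact]
    with y hy hys
  have hfar : 1 + 2 * (h x - h z) / α < ‖y - x‖ := by
    simpa [dist_eq_norm] using hy
  have hone : 1 ≤ ‖y - x‖ :=
    (le_add_of_nonneg_right (div_nonneg (by linarith) hα.le)).trans hfar.le
  have hgrow := add_mul_le_of_one_le_norm_sub hc hx hys hz hone
  have hpos : 0 ≤ α / 2 * (‖y - x‖ - 1) - (h x - h z) := by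
    have := (div_lt_iff₀ hα).1 (lt_sub_iff_add_lt'.2 hfar)
    linarith
  linarith [mul_nonneg (norm_nonneg (y - x)) hpos]

end StrongConvexity

/-! ### Projected supergradient ascent -/

section ProjectedAscent

variable {H : Type*} [NormedAddCommGroup H] [InnerProductSpace ℝ H] {S T : Set H} {q : H → ℝ}
  {G : H → H} {V L D : ℝ} {lam mu nu : H}

theorem concaveOn_of_supergradient (hS : Convex ℝ S)
    (hG : ∀ lam ∈ S, ∀ mu ∈ S, q mu ≤ q lam + ⟪G lam, mu - lam⟫) : ConcaveOn ℝ S q := by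
  refine ⟨hS, fun x hx y hy a c ha hc hac => ?_⟩
  have hz := hS hx hy ha hc hac
  have hzero : a • (x - (a • x + c • y)) + c • (y - (a • x + c • y)) = 0 := by
    obtain rfl := eq_sub_of_add_eq hac
    module
  have hinner : a * ⟪G (a • x + c • y), x - (a • x + c • y)⟫ +
      c * ⟪G (a • x + c • y), y - (a • x + c • y)⟫ = 0 := by
    rw [← inner_smul_right, ← inner_smul_right, ← inner_add_right, hzero, inner_zero_right]
  have hx' := mul_le_mul_of_nonneg_left (hG _ hz x hx) ha
  have hy' := mul_le_mul_of_nonneg_left (hG _ hz y hy) hc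
  simp only [smul_eq_mul]
  linear_combination hx' + hy' + q (a • x + c • y) * hac + hinner

theorem strongConcaveOn_of_supergradient (hT : Convex ℝ T)
    (hG : ∀ lam ∈ T, ∀ mu ∈ T, q mu + L / 2 * ‖mu - lam‖ ^ 2 ≤ q lam + ⟪G lam, mu - lam⟫) :
    StrongConcaveOn T L q := by
  rw [strongConcaveOn_iff_convex]
  refine concaveOn_of_supergradient (G := fun lam => G lam + L • lam) hT fun lam hl mu hm => ?_
  have hexpand : ‖mu‖ ^ 2 = ‖lam‖ ^ 2 + 2 * ⟪lam, mu - lam⟫ + ‖mu - lam‖ ^ 2 := by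
    rw [← norm_add_sq_real, add_sub_cancel]
  rw [inner_add_left, real_inner_smul_left]
  linear_combination hG lam hl mu hm + L / 2 * hexpand

theorem add_sq_le_of_strongConcaveOn (hq : StrongConcaveOn T L q) (hlam : lam ∈ T)
    (hG : ∀ mu ∈ T, q mu ≤ q lam + ⟪G lam, mu - lam⟫) (hmu : mu ∈ T) :
    q mu + L / 2 * ‖mu - lam‖ ^ 2 ≤ q lam + ⟪G lam, mu - lam⟫ := by
  have hconv : StrongConvexOn T L fun nu => -q nu + ⟪G lam, nu⟫ :=
    strongConvexOn_add_convexOn (UniformConcaveOn.neg hq) ((innerₛₗ ℝ (G lam)).convexOn hq.1)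
  have hmin : IsMinOn (fun nu => -q nu + ⟪G lam, nu⟫) T lam := isMinOn_iff.2 fun nu hnu => by
    have := hG nu hnu
    rw [inner_sub_right] at this
    linarith
  have := add_sq_le_of_isMinOn hconv hlam hmin hmu
  rw [inner_sub_right]
  linarith

/-- `G` selects, at every point of `S`, a supergradient of `q` whose supporting inequality has the
slack `‖G mu - G lam‖ ^ 2 / (2 * V)`. On the whole space this says that `q` is concave with
`V`-Lipschitz gradient `G`; on a proper subset it is the stronger, cocoercive form of that
property. -/
def IsCocoerciveSupergradientOn (S : Set H) (q : H → ℝ) (G : H → H) (V : ℝ) : Prop :=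
  ∀ lam ∈ S, ∀ mu ∈ S, q mu + ‖G mu - G lam‖ ^ 2 / (2 * V) ≤ q lam + ⟪G lam, mu - lam⟫

namespace IsCocoerciveSupergradientOn

theorem le_add_inner (hG : IsCocoerciveSupergradientOn S q G V) (hV : 0 < V) (hlam : lam ∈ S)
    (hmu : mu ∈ S) : q mu ≤ q lam + ⟪G lam, mu - lam⟫ :=
  (le_add_of_nonneg_right (by positivity)).trans (hG lam hlam mu hmu)

theorem sq_le_inner (hG : IsCocoerciveSupergradientOn S q G V) (hV : 0 < V) (hlam : lam ∈ S)
    (hmu : mu ∈ S) : ‖G mu - G lam‖ ^ 2 ≤ V * ⟪G lam - G mu, mu - lam⟫ := by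
  have hlm := hG lam hlam mu hmu
  have hml := hG mu hmu lam hlam
  rw [norm_sub_rev, ← neg_sub mu lam, inner_neg_right] at hml
  rw [← div_le_iff₀' hV, inner_sub_left]
  have hhalf : ‖G mu - G lam‖ ^ 2 / (2 * V) = ‖G mu - G lam‖ ^ 2 / V / 2 := by
    rw [div_div, mul_comm]
  linarith

theorem norm_sub_le (hG : IsCocoerciveSupergradientOn S q G V) (hV : 0 < V) (hlam : lam ∈ S)
    (hmu : mu ∈ S) : ‖G mu - G lam‖ ≤ V * ‖mu - lam‖ := by
  rcases (norm_nonneg (G mu - G lam)).eq_or_lt with h0 | hpos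
  · rw [← h0]
    positivity
  · refine le_of_mul_le_mul_left ?_ hpos
    calc ‖G mu - G lam‖ * ‖G mu - G lam‖ = ‖G mu - G lam‖ ^ 2 := (sq _).symm
      _ ≤ V * ⟪G lam - G mu, mu - lam⟫ := hG.sq_le_inner hV hlam hmu
      _ ≤ V * (‖G lam - G mu‖ * ‖mu - lam‖) := by gcongr; exact real_inner_le_norm _ _
      _ = ‖G mu - G lam‖ * (V * ‖mu - lam‖) := by rw [norm_sub_rev]; ring

theorem add_inner_le (hG : IsCocoerciveSupergradientOn S q G V) (hV : 0 < V) (hlam : lam ∈ S)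
    (hmu : mu ∈ S) : q lam + ⟪G lam, mu - lam⟫ ≤ q mu + V / 2 * ‖mu - lam‖ ^ 2 := by
  have hml := hG mu hmu lam hlam
  have hyoung : 0 ≤ ‖(G lam - G mu) - V • (mu - lam)‖ ^ 2 / (2 * V) := by positivity
  rw [norm_sub_sq_real, real_inner_smul_right, norm_smul, Real.norm_of_nonneg hV.le] at hyoung
  rw [← neg_sub mu lam, inner_neg_right] at hml
  have hexpand : (‖G lam - G mu‖ ^ 2 - 2 * (V * ⟪G lam - G mu, mu - lam⟫) +
      (V * ‖mu - lam‖) ^ 2) / (2 * V) = ‖G lam - G mu‖ ^ 2 / (2 * V) -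
      (⟪G lam, mu - lam⟫ - ⟪G mu, mu - lam⟫) + V / 2 * ‖mu - lam‖ ^ 2 := by
    rw [inner_sub_left]
    field_simp
  linarith

theorem hasGradientWithinAt [CompleteSpace H] (hG : IsCocoerciveSupergradientOn S q G V)
    (hV : 0 < V) (hlam : lam ∈ S) : HasGradientWithinAt q (G lam) S lam := by
  rw [hasGradientWithinAt_iff_isLittleO]
  have hquad : (fun mu => q mu - q lam - ⟪G lam, mu - lam⟫) =O[𝓝[S] lam]
      fun mu => ‖mu - lam‖ ^ 2 := by
    refine Asymptotics.IsBigO.of_bound (V / 2) (eventually_mem_nhdsWithin.mono fun mu hmu => ?_)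
    have hupper := hG.le_add_inner hV hlam hmu
    have hlower := hG.add_inner_le hV hlam hmu
    rw [norm_pow, norm_norm, Real.norm_eq_abs, abs_le]
    constructor <;> linarith [mul_nonneg (half_pos hV).le (sq_nonneg ‖mu - lam‖)]
  have hsub : Tendsto (fun mu : H => mu - lam) (𝓝[S] lam) (𝓝 0) :=
    tendsto_sub_nhds_zero_iff.2 (tendsto_id.mono_left nhdsWithin_le_nhds)
  have hpow : (fun v : H => ‖v‖ ^ 2) =o[𝓝 0] fun v => v := by
    simpa using Asymptotics.isLittleO_norm_pow_id (E' := H) one_lt_two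
  exact hquad.trans_isLittleO (hpow.comp_tendsto hsub)

theorem inner_nonpos_of_isMaxOn (hG : IsCocoerciveSupergradientOn S q G V) (hV : 0 < V)
    (hS : Convex ℝ S) (hnu : nu ∈ S) (hmax : IsMaxOn q S nu) (hmu : mu ∈ S) :
    ⟪G nu, mu - nu⟫ ≤ 0 := by
  have hbound : V / 2 * ‖mu - nu‖ ^ 2 ≤ V / 2 * ‖mu - nu‖ ^ 2 - ⟪G nu, mu - nu⟫ := by
    refine le_of_forall_one_sub_mul_le fun s hs => ?_
    have hmem : nu + s • (mu - nu) ∈ S := hS.add_smul_sub_mem hnu hmu ⟨hs.1.le, hs.2.le⟩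
    have hle := (hG.add_inner_le hV hnu hmem).trans (add_le_add_left (hmax hmem) _)
    rw [add_sub_cancel_left, inner_smul_right, norm_smul, Real.norm_of_nonneg hs.1.le] at hle
    have : s * ⟪G nu, mu - nu⟫ ≤ s * (s * (V / 2 * ‖mu - nu‖ ^ 2)) := by linarith
    linarith [le_of_mul_le_mul_left this hs.1]
  linarith

theorem norm_sq_ascent_sub_le (hG : IsCocoerciveSupergradientOn S q G V) (hV : 0 < V)
    (hTS : T ⊆ S) (hq : StrongConcaveOn T L q) (hlam : lam ∈ T) (hnu : nu ∈ T) :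
    ‖lam + V⁻¹ • G lam - (nu + V⁻¹ • G nu)‖ ^ 2 ≤ (1 - L / V) * ‖lam - nu‖ ^ 2 := by
  have hcoc := hG.sq_le_inner hV (hTS hnu) (hTS hlam)
  have hlower {x y : H} (hx : x ∈ T) (hy : y ∈ T) :=
    add_sq_le_of_strongConcaveOn hq hx
      (fun mu hmu => hG.le_add_inner hV (hTS hx) (hTS hmu)) hy
  have hmono : L * ‖lam - nu‖ ^ 2 ≤ ⟪G nu - G lam, lam - nu⟫ := by
    have hln := hlower hlam hnu
    rw [norm_sub_rev, ← neg_sub lam nu, inner_neg_right] at hln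
    rw [inner_sub_left]
    linarith [hlower hnu hlam]
  have hsplit : lam + V⁻¹ • G lam - (nu + V⁻¹ • G nu) =
      (lam - nu) - V⁻¹ • (G nu - G lam) := by module
  rw [hsplit, norm_sub_sq_real, real_inner_smul_right, norm_smul, mul_pow, norm_inv,
    Real.norm_of_nonneg hV.le, norm_sub_rev (G nu), real_inner_comm]
  have hcoc' : V⁻¹ ^ 2 * ‖G lam - G nu‖ ^ 2 ≤ V⁻¹ * ⟪G nu - G lam, lam - nu⟫ := by
    have := mul_le_mul_of_nonneg_left hcoc (by positivity : 0 ≤ V⁻¹ ^ 2)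
    rwa [← mul_assoc, sq V⁻¹, mul_assoc V⁻¹ V⁻¹ V, inv_mul_cancel₀ hV.ne', mul_one,
      ← sq] at this
  have hmono' := mul_le_mul_of_nonneg_left hmono (inv_nonneg.2 hV.le)
  rw [div_eq_inv_mul]
  linarith

end IsCocoerciveSupergradientOn

/-- `p` is the metric projection of `v` onto the convex set `S`, expressed by the variational
inequality, so that no completeness is needed. -/
def IsMetricProjection (S : Set H) (v p : H) : Prop :=
  p ∈ S ∧ ∀ w ∈ S, ⟪v - p, w - p⟫ ≤ 0

theorem IsMetricProjection.norm_sub_le {v v' p p' : H} (h : IsMetricProjection S v p)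
    (h' : IsMetricProjection S v' p') : ‖p - p'‖ ≤ ‖v - v'‖ := by
  have hsq : ‖p - p'‖ ^ 2 ≤ ⟪v - v', p - p'⟫ := by
    have h1 := h.2 p' h'.1
    have h2 := h'.2 p h.1
    have hsplit : ‖p - p'‖ ^ 2 = ⟪v - v', p - p'⟫ + ⟪v - p, p' - p⟫ +
        ⟪v' - p', p - p'⟫ := by
      rw [← neg_sub p p', inner_neg_right, ← sub_eq_add_neg, ← inner_sub_left, ← inner_add_left,
        ← real_inner_self_eq_norm_sq]
      congr 1
      abel
    linarith
  rcases (norm_nonneg (p - p')).eq_or_lt with h0 | hpos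
  · exact h0 ▸ norm_nonneg _
  · have := hsq.trans (real_inner_le_norm _ _)
    rw [sq] at this
    exact le_of_mul_le_mul_right this hpos

namespace IsCocoerciveSupergradientOn

theorem norm_sq_projection_sub_add_le (hG : IsCocoerciveSupergradientOn S q G V) (hV : 0 < V)
    (hlam : lam ∈ S) (hmu : IsMetricProjection S (lam + V⁻¹ • G lam) mu) (hnu : nu ∈ S) :
    ‖mu - nu‖ ^ 2 + 2 / V * (q nu - q mu) ≤ ‖lam - nu‖ ^ 2 := by
  have hsplit : ‖lam - nu‖ ^ 2 =
      ‖mu - lam‖ ^ 2 + ‖mu - nu‖ ^ 2 - 2 * ⟪lam - mu, nu - mu⟫ := by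
    rw [norm_sub_rev mu lam, norm_sub_rev mu nu, ← sub_sub_sub_cancel_right lam nu mu,
      norm_sub_sq_real]
    ring
  have hproj : V * ⟪lam - mu, nu - mu⟫ + ⟪G lam, nu - mu⟫ ≤ 0 := by
    have h := mul_nonpos_of_nonneg_of_nonpos hV.le (hmu.2 nu hnu)
    rwa [add_sub_right_comm, inner_add_left, real_inner_smul_left, mul_add,
      mul_inv_cancel_left₀ hV.ne'] at h
  have hgap : q nu - q mu ≤ ⟪G lam, nu - mu⟫ + V / 2 * ‖mu - lam‖ ^ 2 := by
    have hdiff : ⟪G lam, nu - lam⟫ = ⟪G lam, nu - mu⟫ + ⟪G lam, mu - lam⟫ := by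
      rw [← inner_add_right, sub_add_sub_cancel]
    linarith [hG.le_add_inner hV hlam hnu, hG.add_inner_le hV hlam hmu.1]
  rw [div_mul_eq_mul_div, ← le_sub_iff_add_le', div_le_iff₀ hV, hsplit]
  linarith

theorem norm_sq_projection_sub_le (hG : IsCocoerciveSupergradientOn S q G V) (hV : 0 < V)
    (hS : Convex ℝ S) (hTS : T ⊆ S) (hq : StrongConcaveOn T L q) (hlam : lam ∈ T)
    (hmu : IsMetricProjection S (lam + V⁻¹ • G lam) mu) (hnu : nu ∈ T) (hmax : IsMaxOn q S nu) :
    ‖mu - nu‖ ^ 2 ≤ (1 - L / V) * ‖lam - nu‖ ^ 2 := by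
  have hfix : IsMetricProjection S (nu + V⁻¹ • G nu) nu := by
    refine ⟨hTS hnu, fun w hw => ?_⟩
    rw [add_sub_cancel_left, real_inner_smul_left]
    exact mul_nonpos_of_nonneg_of_nonpos (inv_nonneg.2 hV.le)
      (hG.inner_nonpos_of_isMaxOn hV hS (hTS hnu) hmax hw)
  exact (pow_le_pow_left₀ (norm_nonneg _) (hmu.norm_sub_le hfix) 2).trans
    (hG.norm_sq_ascent_sub_le hV hTS hq hlam hnu)

end IsCocoerciveSupergradientOn

/-- `q` falls off at least quadratically, with constant `L`, away from `nu` inside the part of `S`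
within distance `D` of `nu`. -/
def HasQuadraticDecayOn (S : Set H) (q : H → ℝ) (nu : H) (D L : ℝ) : Prop :=
  ∀ lam ∈ S, ‖lam - nu‖ ≤ D → q lam + L * ‖lam - nu‖ ^ 2 ≤ q nu

namespace HasQuadraticDecayOn

theorem of_strongConcaveOn (hq : StrongConcaveOn {lam | lam ∈ S ∧ ‖lam - nu‖ ≤ D} L q)
    (hnu : nu ∈ S) (hD : 0 ≤ D) (hmax : IsMaxOn q S nu) :
    HasQuadraticDecayOn S q nu D (L / 2) := fun lam hlam hle => by
  have hmin : IsMinOn (-q) {lam | lam ∈ S ∧ ‖lam - nu‖ ≤ D} nu :=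
    isMinOn_iff.2 fun mu hmu => neg_le_neg (isMaxOn_iff.1 hmax mu hmu.1)
  have := add_sq_le_of_isMinOn (UniformConcaveOn.neg hq) ⟨hnu, by simpa using hD⟩ hmin
    ⟨hlam, hle⟩
  simp only [Pi.neg_apply] at this
  linarith

theorem enlarge (h : HasQuadraticDecayOn S q nu D L) (hq : ConcaveOn ℝ S q) (hnu : nu ∈ S)
    (hD : 0 < D) (hL : 0 ≤ L) {R : ℝ} (hDR : D ≤ R) :
    HasQuadraticDecayOn S q nu R (L * D / R) := fun lam hlam hle => by
  have hR : 0 < R := hD.trans_le hDR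
  rcases le_total ‖lam - nu‖ D with hnear | hfar
  · refine le_trans ?_ (h lam hlam hnear)
    gcongr
    exact div_le_of_le_mul₀ hR.le hL (by gcongr)
  set r := ‖lam - nu‖
  have hr : 0 < r := hD.trans_le hfar
  have hDr : D / r ≤ 1 := (div_le_one hr).2 hfar
  have hpoint : (1 - D / r) • nu + (D / r) • lam = nu + (D / r) • (lam - nu) := by module
  have hmem := hq.1 hnu hlam (sub_nonneg.2 hDr) (by positivity : 0 ≤ D / r) (by ring)
  have hconc := hq.2 hnu hlam (sub_nonneg.2 hDr) (by positivity : 0 ≤ D / r) (by ring)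
  have hnorm : ‖nu + (D / r) • (lam - nu) - nu‖ = D := by
    rw [add_sub_cancel_left, norm_smul, Real.norm_of_nonneg (by positivity)]
    exact div_mul_cancel₀ D hr.ne'
  rw [hpoint] at hmem hconc
  have hdecay := h _ hmem hnorm.le
  rw [hnorm] at hdecay
  simp only [smul_eq_mul] at hconc
  have hlinear : D / r * (q lam + L * D * r) ≤ D / r * q nu := by
    have : D / r * (L * D * r) = L * D ^ 2 := by field_simp
    linarith
  calc q lam + L * D / R * r ^ 2 = q lam + L * D * r * (r / R) := by ring
    _ ≤ q lam + L * D * r * 1 := by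
      gcongr
      exact (div_le_one hR).2 hle
    _ = q lam + L * D * r := by rw [mul_one]
    _ ≤ q nu := le_of_mul_le_mul_left hlinear (by positivity)

end HasQuadraticDecayOn

/-- `lam` is a sequence of iterates of projected (super)gradient ascent on `S` along `G`, with
step size `1 / V`. -/
structure IsProjectedAscent (S : Set H) (G : H → H) (V : ℝ) (lam : ℕ → H) : Prop where
  init : lam 0 ∈ S
  step : ∀ t, IsMetricProjection S (lam t + V⁻¹ • G (lam t)) (lam (t + 1))

namespace IsProjectedAscent

variable {lam : ℕ → H}

theorem mem (h : IsProjectedAscent S G V lam) : ∀ t, lam t ∈ S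
  | 0 => h.init
  | t + 1 => (h.step t).1

theorem norm_sub_le_norm_init_sub (h : IsProjectedAscent S G V lam)
    (hG : IsCocoerciveSupergradientOn S q G V) (hV : 0 < V) (hnu : nu ∈ S)
    (hmax : IsMaxOn q S nu) (t : ℕ) : ‖lam t - nu‖ ≤ ‖lam 0 - nu‖ := by
  refine antitone_nat_of_succ_le (f := fun t => ‖lam t - nu‖) (fun t => ?_) (Nat.zero_le t)
  have hstep := hG.norm_sq_projection_sub_add_le hV (h.mem t) (h.step t) hnu
  have hgap : 0 ≤ 2 / V * (q nu - q (lam (t + 1))) :=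
    mul_nonneg (by positivity) (sub_nonneg.2 (hmax (h.mem _)))
  exact (sq_le_sq₀ (norm_nonneg _) (norm_nonneg _)).1 (by linarith)

theorem exists_norm_sq_sub_le_geometric (h : IsProjectedAscent S G V lam)
    (hG : IsCocoerciveSupergradientOn S q G V) (hV : 0 < V) (hS : Convex ℝ S) (hnu : nu ∈ S)
    (hmax : IsMaxOn q S nu) (hdecay : HasQuadraticDecayOn S q nu D L) (hD : 0 < D)
    (hL : 0 < L) :
    ∃ r ∈ Ioo (0 : ℝ) 1, ∀ t, ‖lam t - nu‖ ^ 2 ≤ r ^ t * ‖lam 0 - nu‖ ^ 2 := by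
  set R := max D ‖lam 0 - nu‖
  have hR : 0 < R := hD.trans_le (le_max_left _ _)
  have hconc : ConcaveOn ℝ S q :=
    concaveOn_of_supergradient hS fun _ hlam _ hmu => hG.le_add_inner hV hlam hmu
  have hglobal := hdecay.enlarge hconc hnu hD hL.le (le_max_left D ‖lam 0 - nu‖)
  set c := 2 / V * (L * D / R)
  have hc : 0 < c := mul_pos (div_pos two_pos hV) (div_pos (mul_pos hL hD) hR)
  refine ⟨(1 + c)⁻¹, ⟨by positivity, inv_lt_one_of_one_lt₀ (by linarith)⟩, fun t => ?_⟩
  refine le_geom (u := fun t => ‖lam t - nu‖ ^ 2) (by positivity) t fun k _ => ?_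
  have hstep := hG.norm_sq_projection_sub_add_le hV (h.mem k) (h.step k) hnu
  have hnear := (h.norm_sub_le_norm_init_sub hG hV hnu hmax (k + 1)).trans (le_max_right D _)
  have hgap := mul_le_mul_of_nonneg_left
    (le_sub_iff_add_le'.2 (hglobal _ (h.mem (k + 1)) hnear)) (by positivity : 0 ≤ 2 / V)
  rw [← div_eq_inv_mul, le_div_iff₀ (by positivity)]
  change _ ≤ _ * (q nu - q (lam (k + 1))) at hgap
  have hassoc : 2 / V * (L * D / R * ‖lam (k + 1) - nu‖ ^ 2) = c * ‖lam (k + 1) - nu‖ ^ 2 :=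
    (mul_assoc _ _ _).symm
  linarith [hassoc]

end IsProjectedAscent

end ProjectedAscent

/-! ### The dual function of a strongly convex program -/

theorem inner_eq_sum {d : ℕ} (u v : E d) : ⟪u, v⟫ = ∑ k, u k * v k := by
  rw [PiLp.inner_apply]
  exact Finset.sum_congr rfl fun k _ => by simp [mul_comm]

theorem convex_orthant (d : ℕ) : Convex ℝ (orthant d) := fun _ hu _ hv _ _ ha hc _ k =>
  add_nonneg (mul_nonneg ha (hu k)) (mul_nonneg hc (hv k))

theorem isMetricProjection_orthant {d : ℕ} (v : E d) :
    IsMetricProjection (orthant d) v (WithLp.toLp 2 fun k => max (v k) 0) := by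
  refine ⟨fun k => le_max_right _ _, fun w hw => ?_⟩
  rw [inner_eq_sum]
  refine Finset.sum_nonpos fun k _ => ?_
  change (v k - max (v k) 0) * (w k - max (v k) 0) ≤ 0
  rcases le_total (v k) 0 with h | h
  · rw [max_eq_right h, sub_zero, sub_zero]
    exact mul_nonpos_of_nonpos_of_nonneg h (hw k)
  · rw [max_eq_left h, sub_self, zero_mul]

section Program

variable {m n : ℕ} {X : Set (E n)} {f : E n → ℝ} {g : Fin m → E n → ℝ} {lam mu lams : E m}
  {x y xs : E n} {α β V : ℝ}

/-- The vector `(g_1(x), …, g_m(x))` of the values of the constraint functions. -/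
noncomputable def conVec (g : Fin m → E n → ℝ) (x : E n) : E m :=
  WithLp.toLp 2 fun k => g k x

theorem lagrangian_eq_add_inner (f : E n → ℝ) (g : Fin m → E n → ℝ) (lam : E m) (x : E n) :
    lagrangian f g lam x = f x + ⟪lam, conVec g x⟫ := by
  rw [inner_eq_sum]
  rfl

theorem lagrangian_eq_add_inner_sub (f : E n → ℝ) (g : Fin m → E n → ℝ) (lam mu : E m)
    (x : E n) : lagrangian f g mu x = lagrangian f g lam x + ⟪conVec g x, mu - lam⟫ := by
  rw [lagrangian_eq_add_inner, lagrangian_eq_add_inner, inner_sub_right, real_inner_comm mu,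
    real_inner_comm lam]
  ring

theorem strongConvexOn_lagrangian (hf : StrongConvexOn X α f) (hg : ∀ k, ConvexOn ℝ X (g k))
    (hlam : lam ∈ orthant m) : StrongConvexOn X α (lagrangian f g lam) := by
  have hsum (s : Finset (Fin m)) : ConvexOn ℝ X fun x => ∑ k ∈ s, lam k * g k x := by
    induction s using Finset.cons_induction with
    | empty => simpa using convexOn_const (0 : ℝ) hf.1
    | cons k s hk ih =>
      simp only [Finset.sum_cons]
      exact ((hg k).smul (hlam k)).add ih
  exact strongConvexOn_add_convexOn hf (hsum Finset.univ)

/-- `x` attains the minimum over `X` that defines the dual function at `lam`. -/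
def IsLagrangianMin (X : Set (E n)) (f : E n → ℝ) (g : Fin m → E n → ℝ) (lam : E m)
    (x : E n) : Prop :=
  x ∈ X ∧ IsMinOn (lagrangian f g lam) X x

namespace IsLagrangianMin

theorem isLeast (hx : IsLagrangianMin X f g lam x) :
    IsLeast (lagrangian f g lam '' X) (lagrangian f g lam x) :=
  ⟨mem_image_of_mem _ hx.1, forall_mem_image.2 (isMinOn_iff.1 hx.2)⟩

theorem dual_eq (hx : IsLagrangianMin X f g lam x) : dual X f g lam = lagrangian f g lam x :=
  hx.isLeast.csInf_eq

theorem dual_add_sq_le (hf : StrongConvexOn X α f) (hg : ∀ k, ConvexOn ℝ X (g k))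
    (hmu : mu ∈ orthant m) (hx : IsLagrangianMin X f g lam x) (hy : IsLagrangianMin X f g mu y) :
    dual X f g mu + α / 2 * ‖x - y‖ ^ 2 ≤ dual X f g lam + ⟪conVec g x, mu - lam⟫ := by
  rw [hx.dual_eq, hy.dual_eq, ← lagrangian_eq_add_inner_sub]
  exact add_sq_le_of_isMinOn (strongConvexOn_lagrangian hf hg hmu) hy.1 hy.2 hx.1

theorem unique (hα : 0 < α) (hf : StrongConvexOn X α f) (hg : ∀ k, ConvexOn ℝ X (g k))
    (hlam : lam ∈ orthant m) (hx : IsLagrangianMin X f g lam x)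
    (hy : IsLagrangianMin X f g lam y) : x = y := by
  have h := dual_add_sq_le hf hg hlam hx hy
  rw [sub_self, inner_zero_right, add_zero, add_le_iff_nonpos_right] at h
  have hsq : ‖x - y‖ ^ 2 ≤ 0 := nonpos_of_mul_nonpos_right h (by positivity)
  exact sub_eq_zero.1 (norm_eq_zero.1 (pow_eq_zero_iff two_ne_zero |>.1
    (hsq.antisymm (sq_nonneg _))))

end IsLagrangianMin

theorem DualAttained.exists_isLagrangianMin (h : DualAttained X f g) (hlam : lam ∈ orthant m) :
    ∃ x, IsLagrangianMin X f g lam x := by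
  obtain ⟨⟨x, hx, hval⟩, hlower⟩ := h lam hlam
  exact ⟨x, hx, isMinOn_iff.2 fun y hy => hval.le.trans (hlower (mem_image_of_mem _ hy))⟩

theorem dualAttained_of_exists_isLagrangianMin
    (h : ∀ lam ∈ orthant m, ∃ x, IsLagrangianMin X f g lam x) : DualAttained X f g :=
  fun lam hlam => by
    obtain ⟨x, hx⟩ := h lam hlam
    exact hx.dual_eq ▸ hx.isLeast

theorem dualAttained_of_strongConvexOn (hα : 0 < α) (hf : StrongConvexOn X α f)
    (hg : ∀ k, ConvexOn ℝ X (g k)) (hX : IsClosed X) (hne : X.Nonempty) (hfc : ContinuousOn f X)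
    (hgc : ∀ k, ContinuousOn (g k) X) : DualAttained X f g :=
  dualAttained_of_exists_isLagrangianMin fun _ hlam =>
    exists_isMinOn_of_strongConvexOn hα (strongConvexOn_lagrangian hf hg hlam) hX hne
      (hfc.add (continuousOn_finsetSum _ fun k _ => continuousOn_const.mul (hgc k)))

/-- A minimizer of the Lagrangian at `lam` over `X`, arbitrary if there is none. -/
noncomputable def lagrangianArgmin (X : Set (E n)) (f : E n → ℝ) (g : Fin m → E n → ℝ)
    (lam : E m) : E n :=
  Classical.epsilon (IsLagrangianMin X f g lam)

theorem DualAttained.isLagrangianMin_lagrangianArgmin (h : DualAttained X f g)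
    (hlam : lam ∈ orthant m) : IsLagrangianMin X f g lam (lagrangianArgmin X f g lam) :=
  Classical.epsilon_spec (h.exists_isLagrangianMin hlam)

/-- The values of the constraints at a minimizer of the Lagrangian. For a strongly convex program
this is the gradient of the dual function (Danskin's theorem). -/
noncomputable def dualGradient (X : Set (E n)) (f : E n → ℝ) (g : Fin m → E n → ℝ) (lam : E m) :
    E m :=
  conVec g (lagrangianArgmin X f g lam)

theorem IsLagrangianMin.dualGradient_eq (hα : 0 < α) (hf : StrongConvexOn X α f)
    (hg : ∀ k, ConvexOn ℝ X (g k)) (hlam : lam ∈ orthant m) (hx : IsLagrangianMin X f g lam x) :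
    dualGradient X f g lam = conVec g x :=
  congrArg (conVec g) (unique hα hf hg hlam (Classical.epsilon_spec ⟨x, hx⟩) hx)

namespace StronglyConvexProblem

theorem norm_conVec_sub_sq_le (h : StronglyConvexProblem X f g α β) (hx : x ∈ X) (hy : y ∈ X) :
    ‖conVec g y - conVec g x‖ ^ 2 ≤ m * β ^ 2 * ‖y - x‖ ^ 2 := by
  have hcoord (k : Fin m) : (g k y - g k x) ^ 2 ≤ (β * ‖y - x‖) ^ 2 := by
    rw [← sq_abs]
    exact pow_le_pow_left₀ (abs_nonneg _) (h.2.2.2 k x hx y hy) 2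
  calc ‖conVec g y - conVec g x‖ ^ 2 = ∑ k, (g k y - g k x) ^ 2 :=
        EuclideanSpace.real_norm_sq_eq _
    _ ≤ ∑ _k : Fin m, (β * ‖y - x‖) ^ 2 := Finset.sum_le_sum fun k _ => hcoord k
    _ = m * β ^ 2 * ‖y - x‖ ^ 2 := by
      rw [Finset.sum_const, Finset.card_univ, Fintype.card_fin, nsmul_eq_mul, mul_pow, mul_assoc]

theorem isCocoerciveSupergradientOn (h : StronglyConvexProblem X f g α β)
    (hg : ∀ k, ConvexOn ℝ X (g k)) (hatt : DualAttained X f g) (hV : 0 < V)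
    (hV' : m * β ^ 2 / α ≤ V) :
    IsCocoerciveSupergradientOn (orthant m) (dual X f g) (dualGradient X f g) V :=
  fun lam hlam mu hmu => by
    obtain ⟨x, hx⟩ := hatt.exists_isLagrangianMin hlam
    obtain ⟨y, hy⟩ := hatt.exists_isLagrangianMin hmu
    rw [hx.dualGradient_eq h.1 h.2.1 hg hlam, hy.dualGradient_eq h.1 h.2.1 hg hmu]
    refine le_trans ?_ (hx.dual_add_sq_le h.2.1 hg hmu hy)
    gcongr
    rw [div_le_iff₀ (by positivity), norm_sub_rev]
    calc ‖conVec g x - conVec g y‖ ^ 2 ≤ m * β ^ 2 * ‖x - y‖ ^ 2 :=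
          h.norm_conVec_sub_sq_le hy.1 hx.1
      _ ≤ V * α * ‖x - y‖ ^ 2 :=
        mul_le_mul_of_nonneg_right ((div_le_iff₀ h.1).1 hV') (sq_nonneg _)
      _ = α / 2 * ‖x - y‖ ^ 2 * (2 * V) := by ring

theorem smoothDual (h : StronglyConvexProblem X f g α β) (hg : ∀ k, ConvexOn ℝ X (g k))
    (hatt : DualAttained X f g) (hV : 0 < V) (hV' : m * β ^ 2 / α ≤ V) : SmoothDual X f g V := by
  have hG := h.isCocoerciveSupergradientOn hg hatt hV hV'
  exact ⟨hV, dualGradient X f g, fun _ hlam => hG.hasGradientWithinAt hV hlam,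
    fun _ hlam _ hmu => hG.norm_sub_le hV hlam hmu⟩

theorem exists_smoothDual (h : StronglyConvexProblem X f g α β) (hg : ∀ k, ConvexOn ℝ X (g k))
    (hatt : DualAttained X f g) : ∃ γ, SmoothDual X f g γ := by
  have hnonneg : 0 ≤ m * β ^ 2 / α := div_nonneg (by positivity) h.1.le
  exact ⟨m * β ^ 2 / α + 1, h.smoothDual hg hatt (by linarith) (by linarith)⟩

end StronglyConvexProblem

/-! ### Lagrange multipliers -/

theorem lagrangian_le_of_mem_feasible (hlam : lam ∈ orthant m) (hx : x ∈ feasible X g) :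
    lagrangian f g lam x ≤ f x :=
  add_le_of_nonpos_right (Finset.sum_nonpos fun k _ =>
    mul_nonpos_of_nonneg_of_nonpos (hlam k) (hx.2 k))

theorem DualAttained.dual_le_of_mem_feasible (h : DualAttained X f g) (hlam : lam ∈ orthant m)
    (hx : x ∈ feasible X g) : dual X f g lam ≤ f x :=
  ((h lam hlam).2 (mem_image_of_mem _ hx.1)).trans (lagrangian_le_of_mem_feasible hlam hx)

theorem IsOptimal.isLeast (hxs : IsOptimal X f g xs) : IsLeast (f '' feasible X g) (f xs) :=
  ⟨mem_image_of_mem f hxs.1, forall_mem_image.2 (isMinOn_iff.1 hxs.2)⟩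

namespace IsLagrangeMultiplier

theorem dual_eq (h : IsLagrangeMultiplier X f g lams) (hxs : IsOptimal X f g xs) :
    dual X f g lams = f xs :=
  h.2.unique hxs.isLeast

theorem isMaxOn (h : IsLagrangeMultiplier X f g lams) (hxs : IsOptimal X f g xs)
    (hatt : DualAttained X f g) : IsMaxOn (dual X f g) (orthant m) lams :=
  isMaxOn_iff.2 fun _ hlam => h.dual_eq hxs ▸ hatt.dual_le_of_mem_feasible hlam hxs.1

theorem isLagrangianMin (h : IsLagrangeMultiplier X f g lams) (hxs : IsOptimal X f g xs)
    (hatt : DualAttained X f g) : IsLagrangianMin X f g lams xs :=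
  ⟨hxs.1.1, isMinOn_iff.2 fun y hy => calc
    lagrangian f g lams xs ≤ f xs := lagrangian_le_of_mem_feasible h.1 hxs.1
    _ = dual X f g lams := (h.dual_eq hxs).symm
    _ ≤ lagrangian f g lams y := (hatt lams h.1).2 (mem_image_of_mem _ hy)⟩

theorem inner_conVec_eq_zero (h : IsLagrangeMultiplier X f g lams) (hxs : IsOptimal X f g xs)
    (hatt : DualAttained X f g) : ⟪lams, conVec g xs⟫ = 0 := by
  have hval := (h.isLagrangianMin hxs hatt).dual_eq
  rw [h.dual_eq hxs, lagrangian_eq_add_inner] at hval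
  linarith

theorem apply_eq_zero (h : IsLagrangeMultiplier X f g lams) (hxs : IsOptimal X f g xs)
    (hatt : DualAttained X f g) {k : Fin m} (hk : g k xs ≠ 0) : lams k = 0 := by
  have hsum := h.inner_conVec_eq_zero hxs hatt
  rw [inner_eq_sum] at hsum
  have hzero := (Finset.sum_eq_zero_iff_of_nonpos fun j _ =>
    mul_nonpos_of_nonneg_of_nonpos (h.1 j) (hxs.1.2 j)).1 hsum k (Finset.mem_univ k)
  exact (mul_eq_zero.1 hzero).resolve_right hk

end IsLagrangeMultiplier

theorem isLagrangeMultiplier_of_isLagrangianMin (hxs : IsOptimal X f g xs)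
    (hlams : lams ∈ orthant m) (hmin : IsLagrangianMin X f g lams xs)
    (hslack : ∀ k, lams k * g k xs = 0) : IsLagrangeMultiplier X f g lams := by
  have hval : dual X f g lams = f xs := by
    rw [hmin.dual_eq, lagrangian, Finset.sum_eq_zero fun k _ => hslack k, add_zero]
  exact ⟨hlams, hval ▸ hxs.isLeast⟩

/-! ### The drift-plus-penalty iteration -/

theorem lagrangian_inv_smul (hV : 0 < V) (f : E n → ℝ) (g : Fin m → E n → ℝ) (Q : E m)
    (y : E n) : V * lagrangian f g (V⁻¹ • Q) y = V * f y + ∑ k, Q k * g k y := by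
  rw [lagrangian, mul_add, Finset.mul_sum]
  congr 1
  refine Finset.sum_congr rfl fun k _ => ?_
  rw [PiLp.smul_apply, smul_eq_mul, mul_assoc, mul_inv_cancel_left₀ hV.ne']

theorem isMinOn_drift_plus_penalty_iff (hV : 0 < V) (Q : E m) :
    IsMinOn (fun y => V * f y + ∑ k, Q k * g k y) X x ↔
      IsMinOn (lagrangian f g (V⁻¹ • Q)) X x := by
  simp only [isMinOn_iff, ← lagrangian_inv_smul hV, mul_le_mul_iff_right₀ hV]

theorem inv_smul_mem_orthant (hV : 0 < V) {Q : E m} (hQ : Q ∈ orthant m) :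
    V⁻¹ • Q ∈ orthant m := fun k =>
  mul_nonneg (inv_nonneg.2 hV.le) (hQ k)

theorem DualAttained.runsExist (h : DualAttained X f g) : RunsExist X f g := fun V hV Q₀ hQ₀ => by
  let Q : ℕ → E m := Nat.rec Q₀ fun _ Qt =>
    WithLp.toLp 2 fun k => max (Qt k + g k (lagrangianArgmin X f g (V⁻¹ • Qt))) 0
  have hQ : ∀ t, Q t ∈ orthant m
    | 0 => hQ₀
    | t + 1 => fun k => le_max_right _ _
  let x : ℕ → E n := fun t => lagrangianArgmin X f g (V⁻¹ • Q t)
  have hx (t : ℕ) : IsLagrangianMin X f g (V⁻¹ • Q t) (x t) :=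
    h.isLagrangianMin_lagrangianArgmin (inv_smul_mem_orthant hV (hQ t))
  let xbar : ℕ → E n := fun t =>
    (((2 * (t / 2) : ℕ) : ℝ) / 2)⁻¹ • ∑ τ ∈ Finset.Icc (t / 2) (2 * (t / 2) - 1), x τ
  refine ⟨x, Q, xbar, ⟨hV, hQ₀, fun t => (hx t).1,
    fun t => (isMinOn_drift_plus_penalty_iff hV (Q t)).2 (hx t).2, fun _ _ => rfl,
    fun t ht => ?_, fun t ht => ?_⟩, rfl⟩
  · simp only [xbar, Nat.two_mul_div_two_of_even ht, Nat.add_sub_cancel]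
  · have hhalf : (t + 1) / 2 = t / 2 := by
      obtain ⟨j, hj⟩ := ht
      omega
    simp only [xbar, hhalf]

namespace IsRun

variable {x : ℕ → E n} {Q : ℕ → E m} {xbar : ℕ → E n}

theorem queue_mem_orthant (h : IsRun X f g V x Q xbar) : ∀ t, Q t ∈ orthant m
  | 0 => h.init
  | t + 1 => fun k => h.queue t k ▸ le_max_right _ _

theorem isLagrangianMin (h : IsRun X f g V x Q xbar) (t : ℕ) :
    IsLagrangianMin X f g (V⁻¹ • Q t) (x t) :=
  ⟨h.mem t, (isMinOn_drift_plus_penalty_iff h.V_pos (Q t)).1 (h.argmin t)⟩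

theorem dualGradient_eq (h : IsRun X f g V x Q xbar) (hα : 0 < α) (hf : StrongConvexOn X α f)
    (hg : ∀ k, ConvexOn ℝ X (g k)) (t : ℕ) :
    dualGradient X f g (V⁻¹ • Q t) = conVec g (x t) :=
  (h.isLagrangianMin t).dualGradient_eq hα hf hg
    (inv_smul_mem_orthant h.V_pos (h.queue_mem_orthant t))

theorem isProjectedAscent (h : IsRun X f g V x Q xbar) (hα : 0 < α) (hf : StrongConvexOn X α f)
    (hg : ∀ k, ConvexOn ℝ X (g k)) :
    IsProjectedAscent (orthant m) (dualGradient X f g) V fun t => V⁻¹ • Q t := by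
  refine ⟨inv_smul_mem_orthant h.V_pos h.init, fun t => ?_⟩
  rw [h.dualGradient_eq hα hf hg t, ← smul_add]
  have hnext : V⁻¹ • Q (t + 1) =
      WithLp.toLp 2 fun k => max ((V⁻¹ • (Q t + conVec g (x t))) k) 0 := by
    ext k
    rw [PiLp.smul_apply, smul_eq_mul, h.queue t k, mul_max_of_nonneg _ _ (inv_nonneg.2 h.V_pos.le),
      mul_zero]
    rfl
  exact hnext ▸ isMetricProjection_orthant _

theorem xbar_eq_sum_Ico (h : IsRun X f g V x Q xbar) {t : ℕ} (ht : 2 ≤ t) :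
    xbar t = ((t / 2 : ℕ) : ℝ)⁻¹ • ∑ τ ∈ Finset.Ico (t / 2) (2 * (t / 2)), x τ := by
  have heven {p : ℕ} (hp : 1 ≤ p) :
      xbar (2 * p) = (p : ℝ)⁻¹ • ∑ τ ∈ Finset.Ico p (2 * p), x τ := by
    have havg := h.avg_even (2 * p - 1) ⟨p, by omega⟩
    have hcast : ((2 * p : ℕ) : ℝ) / 2 = p := by push_cast; ring
    have hIcc : Finset.Icc p (2 * p - 1) = Finset.Ico p (2 * p) := by
      ext τ
      simp only [Finset.mem_Icc, Finset.mem_Ico]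
      omega
    rwa [Nat.sub_add_cancel (by omega), hcast, Nat.mul_div_cancel_left p two_pos, hIcc] at havg
  rw [← heven (by omega)]
  rcases Nat.even_or_odd' t with ⟨p, rfl | rfl⟩
  · rw [Nat.mul_div_cancel_left p two_pos]
  · rw [h.avg_odd (2 * p) ⟨p, rfl⟩]
    congr 1
    omega

end IsRun

/-! ### Rates of convergence -/

section Rates

variable {y : ℕ → E n} {r r' : ℕ → ℝ} {w : ℝ}

theorem ErrorDecaysLike.mono (h : ErrorDecaysLike f g xs y r) (hr : ∀ᶠ t in atTop, r t ≤ r' t) :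
    ErrorDecaysLike f g xs y r' := by
  obtain ⟨C, hC, h⟩ := h
  refine ⟨C, hC, ?_⟩
  filter_upwards [h, hr] with t ht hrt
  have hCr : C * r t ≤ C * r' t := mul_le_mul_of_nonneg_left hrt hC.le
  exact ⟨ht.1.trans (by gcongr), fun k => (ht.2 k).trans hCr⟩

theorem tendsto_log_one_div : Tendsto (fun ε : ℝ => Real.log (1 / ε)) (𝓝[>] 0) atTop := by
  simp only [one_div, Real.log_inv]
  exact tendsto_neg_atBot_atTop.comp Real.tendsto_log_nhdsGT_zero

theorem pow_le_sq_of_log_le {ε : ℝ} (hw : 0 < w) (hw1 : w < 1) (hε : 0 < ε) {t : ℕ}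
    (ht : 2 / -Real.log w * Real.log (1 / ε) ≤ t) : w ^ t ≤ ε ^ 2 := by
  rw [div_mul_eq_mul_div, div_le_iff₀ (neg_pos.2 (Real.log_neg hw hw1)), one_div,
    Real.log_inv] at ht
  rw [← Real.log_le_log_iff (by positivity) (by positivity), Real.log_pow, Real.log_pow,
    Nat.cast_ofNat]
  linarith

theorem ErrorDecaysLike.hasConvergenceTime_log (h : ErrorDecaysLike f g xs y fun t => w ^ t)
    (hw : w ∈ Ioo (0 : ℝ) 1) (hy : ∀ᶠ t in atTop, y t ∈ X) :
    HasConvergenceTime X f g xs y fun ε => Real.log (1 / ε) := by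
  obtain ⟨C, hC, h⟩ := h
  obtain ⟨T, hT⟩ := eventually_atTop.1 (h.and hy)
  have hrate : 0 < 2 / -Real.log w := div_pos two_pos (neg_pos.2 (Real.log_neg hw.1 hw.2))
  refine ⟨2 / -Real.log w, hrate, ?_⟩
  filter_upwards [(tendsto_log_one_div.const_mul_atTop hrate).eventually_ge_atTop (T : ℝ),
    Ioo_mem_nhdsGT (inv_pos.2 hC)] with ε hεT hε t ht
  obtain ⟨⟨hobj, hcon⟩, hmem⟩ := hT t (by exact_mod_cast hεT.trans ht)
  have herror : C * w ^ t ≤ ε := calc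
    C * w ^ t ≤ C * ε ^ 2 := by
      gcongr
      exact pow_le_sq_of_log_le hw.1 hw.2 hε.1 ht
    _ = C * ε * ε := by ring
    _ ≤ 1 * ε :=
      mul_le_mul_of_nonneg_right ((le_inv_mul_iff₀ hC).1 (by simpa using hε.2.le)) hε.1.le
    _ = ε := one_mul ε
  exact ⟨hmem, hobj.trans (by gcongr), fun k => (hcon k).trans herror⟩

theorem log_one_div_le_rpow {ε : ℝ} (hε : 0 < ε) :
    Real.log (1 / ε) ≤ 3 / 2 * (1 / ε ^ (2 / 3 : ℝ)) := by
  have h := Real.log_le_rpow_div (x := 1 / ε) (ε := 2 / 3) (by positivity) (by norm_num)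
  rw [Real.div_rpow zero_le_one hε.le, Real.one_rpow] at h
  linarith

theorem HasConvergenceTime.mono {h h' : ℝ → ℝ} (H : HasConvergenceTime X f g xs y h) {c : ℝ}
    (hc : 0 < c) (hh : ∀ᶠ ε in 𝓝[>] 0, h ε ≤ c * h' ε) : HasConvergenceTime X f g xs y h' := by
  obtain ⟨C, hC, H⟩ := H
  refine ⟨C * c, by positivity, ?_⟩
  filter_upwards [H, hh] with ε hε hle t ht
  refine hε t (le_trans ?_ ht)
  rw [mul_assoc]
  gcongr

theorem eventually_pow_le_one_div_rpow (hw0 : 0 ≤ w) (hw1 : w < 1) :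
    ∀ᶠ t : ℕ in atTop, w ^ t ≤ 1 / (t : ℝ) ^ (3 / 2 : ℝ) := by
  have hlim := tendsto_pow_const_mul_const_pow_of_lt_one 2 hw0 hw1
  filter_upwards [hlim.eventually_le_const one_pos, eventually_ge_atTop 1] with t ht ht1
  have ht1' : (1 : ℝ) ≤ t := by exact_mod_cast ht1
  have hexp : (t : ℝ) ^ (3 / 2 : ℝ) ≤ (t : ℝ) ^ 2 := by
    rw [← Real.rpow_natCast]
    exact Real.rpow_le_rpow_of_exponent_le ht1' (by norm_num)
  rw [le_div_iff₀ (by positivity), mul_comm]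
  exact (mul_le_mul_of_nonneg_right hexp (pow_nonneg hw0 t)).trans ht

theorem eventually_pow_two_mul_le (hw0 : 0 ≤ w) (hw1 : w < 1) :
    ∀ᶠ t : ℕ in atTop, w ^ (2 * t) ≤ 1 / (t : ℝ) * w ^ t := by
  filter_upwards [(tendsto_self_mul_const_pow_of_lt_one hw0 hw1).eventually_le_const one_pos,
    eventually_gt_atTop 0] with t ht ht0
  rw [two_mul, pow_add]
  gcongr
  rwa [le_div_iff₀ (by exact_mod_cast ht0), mul_comm]

theorem eventually_one_div_mul_pow_le (hw0 : 0 ≤ w) :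
    ∀ᶠ t : ℕ in atTop, 1 / (t : ℝ) * w ^ t ≤ w ^ t := by
  filter_upwards [eventually_ge_atTop 1] with t ht
  exact mul_le_of_le_one_left (by positivity)
    ((div_le_one (by positivity)).2 (by exact_mod_cast ht))

/-- The objective and constraint errors of `y` decay at least as fast as some geometric
sequence. -/
def HasGeometricRate (f : E n → ℝ) (g : Fin m → E n → ℝ) (xs : E n) (y : ℕ → E n) : Prop :=
  ∃ w ∈ Ioo (0 : ℝ) 1, ErrorDecaysLike f g xs y fun t => w ^ t

namespace HasGeometricRate

theorem errorDecaysLike_rpow (h : HasGeometricRate f g xs y) :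
    ErrorDecaysLike f g xs y fun t => 1 / (t : ℝ) ^ (3 / 2 : ℝ) := by
  obtain ⟨w, hw, h⟩ := h
  exact h.mono (eventually_pow_le_one_div_rpow hw.1.le hw.2)

theorem hasConvergenceTime_log (h : HasGeometricRate f g xs y) (hy : ∀ᶠ t in atTop, y t ∈ X) :
    HasConvergenceTime X f g xs y fun ε => Real.log (1 / ε) := by
  obtain ⟨w, hw, h⟩ := h
  exact h.hasConvergenceTime_log hw hy

theorem hasConvergenceTime_rpow (h : HasGeometricRate f g xs y) (hy : ∀ᶠ t in atTop, y t ∈ X) :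
    HasConvergenceTime X f g xs y fun ε => 1 / ε ^ (2 / 3 : ℝ) :=
  (h.hasConvergenceTime_log hy).mono (by norm_num)
    (eventually_mem_nhdsWithin.mono fun _ hε => log_one_div_le_rpow hε)

end HasGeometricRate

end Rates

theorem IsLagrangianMin.le_add_norm_mul (hx : IsLagrangianMin X f g lam x) (hy : y ∈ X) :
    f x ≤ f y + ‖lam‖ * ‖conVec g x - conVec g y‖ := by
  have hmin := isMinOn_iff.1 hx.2 y hy
  rw [lagrangian_eq_add_inner, lagrangian_eq_add_inner] at hmin
  have hCS := real_inner_le_norm lam (conVec g y - conVec g x)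
  rw [inner_sub_right, norm_sub_rev] at hCS
  linarith

theorem apply_le_add_norm_conVec_sub (g : Fin m → E n → ℝ) (x y : E n) (k : Fin m) :
    g k x ≤ g k y + ‖conVec g x - conVec g y‖ :=
  sub_le_iff_le_add'.1 ((le_abs_self _).trans
    (PiLp.norm_apply_le (conVec g x - conVec g y) k))

theorem errorDecaysLike_of_norm_conVec_sub_le {lam : ℕ → E m} {x : ℕ → E n} {r : ℕ → ℝ} {B C : ℝ}
    (hx : ∀ t, IsLagrangianMin X f g (lam t) (x t)) (hxs : xs ∈ feasible X g)
    (hB : ∀ t, ‖lam t‖ ≤ B) (hC : 0 < C)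
    (hdist : ∀ᶠ t in atTop, ‖conVec g (x t) - conVec g xs‖ ≤ C * r t) :
    ErrorDecaysLike f g xs x r := by
  have hB0 : 0 ≤ B := (norm_nonneg _).trans (hB 0)
  refine ⟨(B + 1) * C, by positivity, hdist.mono fun t ht => ?_⟩
  have hCr : 0 ≤ C * r t := (norm_nonneg _).trans ht
  have hobj : ‖lam t‖ * ‖conVec g (x t) - conVec g xs‖ ≤ B * (C * r t) :=
    mul_le_mul (hB t) ht (norm_nonneg _) hB0
  refine ⟨by linarith [(hx t).le_add_norm_mul hxs.1], fun k => ?_⟩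
  linarith [apply_le_add_norm_conVec_sub g (x t) xs k, hxs.2 k, mul_nonneg hB0 hCr]

theorem exists_eventually_le_mul_pow {u : ℕ → ℝ} {ρ : ℝ} (hρ : 0 ≤ ρ)
    (hu : ∀ᶠ t in atTop, u (t + 1) ≤ ρ * u t) : ∃ C > 0, ∀ᶠ t in atTop, u t ≤ C * ρ ^ t := by
  obtain ⟨T, hT⟩ := eventually_atTop.1 hu
  refine ⟨|u T| * (ρ ^ T)⁻¹ + 1, by positivity, ?_⟩
  filter_upwards [eventually_gt_atTop T] with t ht
  have hgeom : u t ≤ ρ ^ (t - T) * u T := by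
    have := le_geom (u := fun s => u (T + s)) hρ (t - T) fun s _ => hT (T + s) (by omega)
    rwa [Nat.add_sub_cancel' ht.le] at this
  have hshift : ρ ^ (t - T) = (ρ ^ T)⁻¹ * ρ ^ t := by
    rcases hρ.eq_or_lt with rfl | hpos
    · rw [zero_pow (Nat.sub_ne_zero_of_lt ht), zero_pow (Nat.ne_zero_of_lt ht), mul_zero]
    · rw [pow_sub₀ ρ hpos.ne' ht.le, mul_comm]
  calc u t ≤ (ρ ^ T)⁻¹ * ρ ^ t * |u T| := hgeom.trans (by rw [hshift]; gcongr; exact le_abs_self _)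
    _ = |u T| * (ρ ^ T)⁻¹ * ρ ^ t := by ring
    _ ≤ (|u T| * (ρ ^ T)⁻¹ + 1) * ρ ^ t := by
      gcongr
      linarith

theorem average_le_add_of_le_add_pow {φ : E n → ℝ} (hφ : ConvexOn ℝ X φ) {x : ℕ → E n}
    (hx : ∀ t, x t ∈ X) {p : ℕ} (hp : 0 < p) {c C r : ℝ} (hC : 0 ≤ C) (hr0 : 0 ≤ r) (hr1 : r < 1)
    (hle : ∀ τ ≥ p, φ (x τ) ≤ c + C * r ^ τ) :
    φ ((p : ℝ)⁻¹ • ∑ τ ∈ Finset.Ico p (2 * p), x τ) ≤ c + (p : ℝ)⁻¹ * (C * (r ^ p / (1 - r))) := by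
  have hcard : ((Finset.Ico p (2 * p)).card : ℝ) = p := by
    rw [Nat.card_Ico, two_mul, Nat.add_sub_cancel]
  have hp' : (p : ℝ) ≠ 0 := by positivity
  calc φ ((p : ℝ)⁻¹ • ∑ τ ∈ Finset.Ico p (2 * p), x τ)
      = φ (∑ τ ∈ Finset.Ico p (2 * p), (p : ℝ)⁻¹ • x τ) := by rw [Finset.smul_sum]
    _ ≤ ∑ τ ∈ Finset.Ico p (2 * p), (p : ℝ)⁻¹ • φ (x τ) := by
      refine hφ.map_sum_le (fun _ _ => by positivity) ?_ fun τ _ => hx τ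
      rw [Finset.sum_const, nsmul_eq_mul, hcard, mul_inv_cancel₀ hp']
    _ ≤ ∑ τ ∈ Finset.Ico p (2 * p), (p : ℝ)⁻¹ • (c + C * r ^ τ) := by
      gcongr with τ hτ
      exact hle τ (Finset.mem_Ico.1 hτ).1
    _ = c + (p : ℝ)⁻¹ * (C * ∑ τ ∈ Finset.Ico p (2 * p), r ^ τ) := by
      rw [← Finset.smul_sum, Finset.sum_add_distrib, Finset.sum_const, nsmul_eq_mul, hcard,
        ← Finset.mul_sum, smul_eq_mul, mul_add, inv_mul_cancel_left₀ hp']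
    _ ≤ c + (p : ℝ)⁻¹ * (C * (r ^ p / (1 - r))) := by
      gcongr
      exact geom_sum_Ico_le_of_lt_one hr0 hr1

theorem pow_two_mul_half_le {w : ℝ} (hw : 0 ≤ w) {t : ℕ} (ht : 2 ≤ t) :
    w ^ (2 * (t / 2)) ≤ (w⁻¹ + 1) * w ^ t := by
  rcases hw.eq_or_lt with rfl | hpos
  · rw [zero_pow (by omega), zero_pow (by omega), mul_zero]
  · rw [add_mul, one_mul]
    rcases Nat.even_or_odd' t with ⟨p, rfl | rfl⟩
    · rw [Nat.mul_div_cancel_left p two_pos]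
      exact le_add_of_nonneg_left (by positivity)
    · rw [pow_succ', inv_mul_cancel_left₀ hpos.ne', show (2 * p + 1) / 2 = p by omega]
      exact le_add_of_nonneg_right (by positivity)

namespace IsRun

variable {x : ℕ → E n} {Q : ℕ → E m} {xbar : ℕ → E n} {w : ℝ}

theorem errorDecaysLike_xbar (h : IsRun X f g V x Q xbar) (hf : ConvexOn ℝ X f)
    (hg : ∀ k, ConvexOn ℝ X (g k)) (hw0 : 0 ≤ w) (hw1 : w < 1)
    (hx : ErrorDecaysLike f g xs x fun t => w ^ (2 * t)) :
    ErrorDecaysLike f g xs xbar fun t => 1 / (t : ℝ) * w ^ t := by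
  obtain ⟨C, hC, hx⟩ := hx
  obtain ⟨T, hT⟩ := eventually_atTop.1 hx
  have hr1 : w ^ 2 < 1 := pow_lt_one₀ hw0 hw1 two_ne_zero
  have hpos : 0 < 1 - w ^ 2 := sub_pos.2 hr1
  refine ⟨3 * C * (w⁻¹ + 1) / (1 - w ^ 2), div_pos (by positivity) hpos, ?_⟩
  filter_upwards [eventually_ge_atTop (2 * T + 2)] with t ht
  have hp : 0 < t / 2 := by omega
  have ht0 : (0 : ℝ) < t := by exact_mod_cast (by omega : 0 < t)
  have hconst : ((t / 2 : ℕ) : ℝ)⁻¹ * (C * ((w ^ 2) ^ (t / 2) / (1 - w ^ 2))) ≤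
      3 * C * (w⁻¹ + 1) / (1 - w ^ 2) * (1 / (t : ℝ) * w ^ t) := by
    have hinv : ((t / 2 : ℕ) : ℝ)⁻¹ ≤ 3 / t := by
      rw [inv_le_comm₀ (by exact_mod_cast hp) (div_pos three_pos ht0), inv_div,
        div_le_iff₀ three_pos]
      exact_mod_cast (by omega : t ≤ t / 2 * 3)
    calc ((t / 2 : ℕ) : ℝ)⁻¹ * (C * ((w ^ 2) ^ (t / 2) / (1 - w ^ 2)))
        ≤ 3 / t * (C * ((w⁻¹ + 1) * w ^ t / (1 - w ^ 2))) := by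
          rw [← pow_mul]
          gcongr
          exact pow_two_mul_half_le hw0 (by omega)
      _ = 3 * C * (w⁻¹ + 1) / (1 - w ^ 2) * (1 / (t : ℝ) * w ^ t) := by ring
  have haverage {φ : E n → ℝ} (hφ : ConvexOn ℝ X φ) {c : ℝ}
      (hle : ∀ τ ≥ t / 2, φ (x τ) ≤ c + C * (w ^ 2) ^ τ) :
      φ (xbar t) ≤ c + 3 * C * (w⁻¹ + 1) / (1 - w ^ 2) * (1 / (t : ℝ) * w ^ t) := by
    rw [h.xbar_eq_sum_Ico (by omega)]
    exact (average_le_add_of_le_add_pow hφ h.mem hp hC.le (sq_nonneg w) hr1 hle).trans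
      (by gcongr)
  simp only [pow_mul] at hT
  refine ⟨haverage hf fun τ hτ => (hT τ (by omega)).1, fun k => ?_⟩
  simpa only [zero_add] using
    haverage (hg k) (c := 0) fun τ hτ => by simpa only [zero_add] using (hT τ (by omega)).2 k

theorem errorDecaysLike_of_norm_sq_sub_le (h : IsRun X f g V x Q xbar)
    (hP : StronglyConvexProblem X f g α β) (hg : ∀ k, ConvexOn ℝ X (g k))
    (hatt : DualAttained X f g) (hV' : m * β ^ 2 / α ≤ V) (hxs : IsOptimal X f g xs)
    (hlams : IsLagrangeMultiplier X f g lams) (hw : 0 ≤ w) {C : ℝ} (hC : 0 < C)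
    (hdist : ∀ᶠ t in atTop, ‖V⁻¹ • Q t - lams‖ ^ 2 ≤ C * (w ^ 4) ^ t) :
    ErrorDecaysLike f g xs x fun t => w ^ (2 * t) := by
  have hV := h.V_pos
  have hG := hP.isCocoerciveSupergradientOn hg hatt hV hV'
  have hasc := h.isProjectedAscent hP.1 hP.2.1 hg
  have hbounded (t : ℕ) : ‖V⁻¹ • Q t‖ ≤ ‖lams‖ + ‖V⁻¹ • Q 0 - lams‖ := by
    rw [← sub_le_iff_le_add']
    exact (norm_sub_norm_le _ _).trans
      (hasc.norm_sub_le_norm_init_sub hG hV hlams.1 (hlams.isMaxOn hxs hatt) t)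
  refine errorDecaysLike_of_norm_conVec_sub_le (C := V * √C) h.isLagrangianMin hxs.1 hbounded
    (by positivity) (hdist.mono fun t ht => ?_)
  have hgrad := hG.norm_sub_le hV hlams.1 (hasc.mem t)
  rw [h.dualGradient_eq hP.1 hP.2.1 hg t,
    (hlams.isLagrangianMin hxs hatt).dualGradient_eq hP.1 hP.2.1 hg hlams.1] at hgrad
  have hroot : ‖V⁻¹ • Q t - lams‖ ≤ √C * w ^ (2 * t) := by
    refine (sq_le_sq₀ (norm_nonneg _) (by positivity)).1 (ht.trans_eq ?_)
    rw [mul_pow, Real.sq_sqrt hC.le]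
    ring
  calc ‖conVec g (x t) - conVec g xs‖ ≤ V * (√C * w ^ (2 * t)) := hgrad.trans (by gcongr)
    _ = V * √C * w ^ (2 * t) := (mul_assoc _ _ _).symm

theorem errorDecaysLike_one_div_mul_pow (h : IsRun X f g V x Q xbar)
    (hP : StronglyConvexProblem X f g α β) (hg : ∀ k, ConvexOn ℝ X (g k))
    (hatt : DualAttained X f g) (hV' : m * β ^ 2 / α ≤ V) (hxs : IsOptimal X f g xs)
    (hlams : IsLagrangeMultiplier X f g lams) (hw0 : 0 ≤ w) (hw1 : w < 1) {C : ℝ} (hC : 0 < C)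
    (hdist : ∀ᶠ t in atTop, ‖V⁻¹ • Q t - lams‖ ^ 2 ≤ C * (w ^ 4) ^ t) :
    (ErrorDecaysLike f g xs x fun t => 1 / (t : ℝ) * w ^ t) ∧
      ErrorDecaysLike f g xs xbar fun t => 1 / (t : ℝ) * w ^ t := by
  have hx := h.errorDecaysLike_of_norm_sq_sub_le hP hg hatt hV' hxs hlams hw0 hC hdist
  exact ⟨hx.mono (eventually_pow_two_mul_le hw0 hw1),
    h.errorDecaysLike_xbar (hP.2.1.strictConvexOn hP.1).convexOn hg hw0 hw1 hx⟩

theorem exists_norm_sq_sub_le_geometric (h : IsRun X f g V x Q xbar)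
    (hP : StronglyConvexProblem X f g α β) (hg : ∀ k, ConvexOn ℝ X (g k))
    (hatt : DualAttained X f g) (hV' : m * β ^ 2 / α ≤ V) (hxs : IsOptimal X f g xs)
    (hlams : IsLagrangeMultiplier X f g lams) {D L : ℝ}
    (hq : LocallyQuadraticDualAt X f g lams D L) :
    ∃ r ∈ Ioo (0 : ℝ) 1, ∀ t, ‖V⁻¹ • Q t - lams‖ ^ 2 ≤ r ^ t * ‖V⁻¹ • Q 0 - lams‖ ^ 2 :=
  (h.isProjectedAscent hP.1 hP.2.1 hg).exists_norm_sq_sub_le_geometric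
    (hP.isCocoerciveSupergradientOn hg hatt h.V_pos hV') h.V_pos (convex_orthant m) hlams.1
    (hlams.isMaxOn hxs hatt) hq.2.2 hq.1 hq.2.1

theorem hasGeometricRate (h : IsRun X f g V x Q xbar) (hP : StronglyConvexProblem X f g α β)
    (hg : ∀ k, ConvexOn ℝ X (g k)) (hatt : DualAttained X f g) (hV' : m * β ^ 2 / α ≤ V)
    (hxs : IsOptimal X f g xs) (hlams : IsLagrangeMultiplier X f g lams) {D L : ℝ}
    (hq : LocallyQuadraticDualAt X f g lams D L) :
    HasGeometricRate f g xs x ∧ HasGeometricRate f g xs xbar := by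
  obtain ⟨r, hr, hgeom⟩ := h.exists_norm_sq_sub_le_geometric hP hg hatt hV' hxs hlams hq
  have hw : r ^ (1 / 4 : ℝ) ∈ Ioo 0 1 :=
    ⟨Real.rpow_pos_of_pos hr.1 _, Real.rpow_lt_one hr.1.le hr.2 (by norm_num)⟩
  have hw4 : (r ^ (1 / 4 : ℝ)) ^ 4 = r := by
    rw [← Real.rpow_mul_natCast hr.1.le]
    norm_num
  have hpow (t : ℕ) : r ^ t * ‖V⁻¹ • Q 0 - lams‖ ^ 2 ≤ (‖V⁻¹ • Q 0 - lams‖ ^ 2 + 1) * r ^ t := by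
    linarith [pow_nonneg hr.1.le t]
  have hrate := h.errorDecaysLike_one_div_mul_pow hP hg hatt hV' hxs hlams hw.1.le hw.2
    (by positivity) (Eventually.of_forall fun t => hw4.symm ▸ (hgeom t).trans (hpow t))
  have hmono := eventually_one_div_mul_pow_le hw.1.le
  exact ⟨⟨_, hw, hrate.1.mono hmono⟩, ⟨_, hw, hrate.2.mono hmono⟩⟩

end IsRun

namespace LocallyStronglyConcaveDualAt

variable {D L : ℝ}

theorem locallyQuadraticDualAt (hq : LocallyStronglyConcaveDualAt X f g lams D L)
    (hlams : IsLagrangeMultiplier X f g lams) (hxs : IsOptimal X f g xs)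
    (hatt : DualAttained X f g) : LocallyQuadraticDualAt X f g lams D (L / 2) :=
  ⟨hq.1, half_pos hq.2.1,
    HasQuadraticDecayOn.of_strongConcaveOn hq.2.2 hlams.1 hq.1.le (hlams.isMaxOn hxs hatt)⟩

theorem one_sub_div_nonneg (hq : LocallyStronglyConcaveDualAt X f g lams D L) (hm : 0 < m)
    (hP : StronglyConvexProblem X f g α β) (hg : ∀ k, ConvexOn ℝ X (g k))
    (hatt : DualAttained X f g) (hV : 0 < V) (hV' : m * β ^ 2 / α ≤ V)
    (hlams : lams ∈ orthant m) : 0 ≤ 1 - L / V := by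
  have hnorm : ‖lams + EuclideanSpace.single ⟨0, hm⟩ D - lams‖ = D := by
    rw [add_sub_cancel_left, PiLp.norm_single, Real.norm_of_nonneg hq.1.le]
  have hmem : lams + EuclideanSpace.single ⟨0, hm⟩ D ∈ orthant m := fun k => by
    rw [PiLp.add_apply, PiLp.single_apply]
    split_ifs
    exacts [add_nonneg (hlams k) hq.1.le, add_nonneg (hlams k) le_rfl]
  have hcontract := (hP.isCocoerciveSupergradientOn hg hatt hV hV').norm_sq_ascent_sub_le hV
    (fun _ h => h.1) hq.2.2 ⟨hmem, hnorm.le⟩ ⟨hlams, by simpa using hq.1.le⟩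
  rw [hnorm] at hcontract
  exact nonneg_of_mul_nonneg_left ((sq_nonneg _).trans hcontract) (pow_pos hq.1 2)

end LocallyStronglyConcaveDualAt

namespace IsRun

variable {x : ℕ → E n} {Q : ℕ → E m} {xbar : ℕ → E n}

theorem eventually_norm_sub_le (h : IsRun X f g V x Q xbar)
    (hP : StronglyConvexProblem X f g α β) (hg : ∀ k, ConvexOn ℝ X (g k))
    (hatt : DualAttained X f g) (hV' : m * β ^ 2 / α ≤ V) (hxs : IsOptimal X f g xs)
    (hlams : IsLagrangeMultiplier X f g lams) {D L : ℝ}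
    (hq : LocallyQuadraticDualAt X f g lams D L) :
    ∀ᶠ t in atTop, ‖V⁻¹ • Q t - lams‖ ≤ D := by
  obtain ⟨r, hr, hgeom⟩ := h.exists_norm_sq_sub_le_geometric hP hg hatt hV' hxs hlams hq
  have hlim : Tendsto (fun t => r ^ t * ‖V⁻¹ • Q 0 - lams‖ ^ 2) atTop (𝓝 0) := by
    simpa only [zero_mul] using
      (tendsto_pow_atTop_nhds_zero_of_lt_one hr.1.le hr.2).mul_const (‖V⁻¹ • Q 0 - lams‖ ^ 2)
  filter_upwards [hlim.eventually_le_const (pow_pos hq.1 2)] with t ht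
  exact (sq_le_sq₀ (norm_nonneg _) hq.1.le).1 ((hgeom t).trans ht)

theorem errorDecaysLike_one_div_mul_rpow (h : IsRun X f g V x Q xbar) (hm : 0 < m)
    (hP : StronglyConvexProblem X f g α β) (hg : ∀ k, ConvexOn ℝ X (g k))
    (hatt : DualAttained X f g) (hV' : m * β ^ 2 / α ≤ V) (hxs : IsOptimal X f g xs)
    (hlams : IsLagrangeMultiplier X f g lams) {D L : ℝ}
    (hq : LocallyStronglyConcaveDualAt X f g lams D L) :
    (ErrorDecaysLike f g xs x fun t => 1 / (t : ℝ) * (1 - L / V) ^ ((t : ℝ) / 4)) ∧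
      ErrorDecaysLike f g xs xbar fun t => 1 / (t : ℝ) * (1 - L / V) ^ ((t : ℝ) / 4) := by
  have hV := h.V_pos
  have hρ0 := hq.one_sub_div_nonneg hm hP hg hatt hV hV' hlams.1
  have hρ1 : 1 - L / V < 1 := sub_lt_self _ (div_pos hq.2.1 hV)
  have hasc := h.isProjectedAscent hP.1 hP.2.1 hg
  have hcontract : ∀ᶠ t in atTop,
      ‖V⁻¹ • Q (t + 1) - lams‖ ^ 2 ≤ (1 - L / V) * ‖V⁻¹ • Q t - lams‖ ^ 2 := by
    filter_upwards [h.eventually_norm_sub_le hP hg hatt hV' hxs hlams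
      (hq.locallyQuadraticDualAt hlams hxs hatt)] with t ht
    exact (hP.isCocoerciveSupergradientOn hg hatt hV hV').norm_sq_projection_sub_le hV
      (convex_orthant m) (fun _ h => h.1) hq.2.2 ⟨hasc.mem t, ht⟩ (hasc.step t)
      ⟨hlams.1, by simpa using hq.1.le⟩ (hlams.isMaxOn hxs hatt)
  obtain ⟨C, hC, hdist⟩ := exists_eventually_le_mul_pow
    (u := fun t => ‖V⁻¹ • Q t - lams‖ ^ 2) hρ0 hcontract
  have hw4 : ((1 - L / V) ^ (1 / 4 : ℝ)) ^ 4 = 1 - L / V := by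
    rw [← Real.rpow_mul_natCast hρ0]
    norm_num
  have hpow (t : ℕ) : (1 - L / V) ^ ((t : ℝ) / 4) = ((1 - L / V) ^ (1 / 4 : ℝ)) ^ t := by
    rw [← Real.rpow_mul_natCast hρ0, one_div_mul_eq_div]
  simp only [hpow]
  exact h.errorDecaysLike_one_div_mul_pow hP hg hatt hV' hxs hlams (Real.rpow_nonneg hρ0 _)
    (Real.rpow_lt_one hρ0 hρ1 (by norm_num)) hC (by rwa [hw4])

end IsRun

end Program

/-! ### Linear constraints -/

section LinearConstraints

variable {m n : ℕ} {A : Matrix (Fin m) (Fin n) ℝ} {b : Fin m → ℝ} {f : E n → ℝ}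
  {lam mu lams : E m} {x y xs : E n} {α : ℝ}

/-- The matrix `A` as a continuous linear map between Euclidean spaces. -/
noncomputable def conMap (A : Matrix (Fin m) (Fin n) ℝ) : E n →L[ℝ] E m :=
  (Matrix.toEuclideanLin A).toContinuousLinearMap

theorem linCon_eq (A : Matrix (Fin m) (Fin n) ℝ) (b : Fin m → ℝ) (k : Fin m) (x : E n) :
    linCon A b k x = conMap A x k - b k :=
  rfl

theorem conVec_linCon_sub (A : Matrix (Fin m) (Fin n) ℝ) (b : Fin m → ℝ) (x y : E n) :
    conVec (linCon A b) x - conVec (linCon A b) y = conMap A (x - y) := by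
  ext k
  rw [map_sub]
  exact sub_sub_sub_cancel_right _ _ _

theorem linCon_add (A : Matrix (Fin m) (Fin n) ℝ) (b : Fin m → ℝ) (k : Fin m) (x v : E n) :
    linCon A b k (x + v) = linCon A b k x + conMap A v k := by
  rw [linCon_eq, linCon_eq, map_add, PiLp.add_apply]
  ring

theorem convexOn_linCon (A : Matrix (Fin m) (Fin n) ℝ) (b : Fin m → ℝ) (k : Fin m) :
    ConvexOn ℝ univ (linCon A b k) :=
  (((EuclideanSpace.projₗ k).comp (conMap A).toLinearMap).convexOn convex_univ).sub
    (concaveOn_const (b k) convex_univ)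

theorem continuous_linCon (A : Matrix (Fin m) (Fin n) ℝ) (b : Fin m → ℝ) (k : Fin m) :
    Continuous (linCon A b k) :=
  ((EuclideanSpace.proj k).comp (conMap A)).continuous.sub continuous_const

theorem exists_stronglyConvexProblem_linCon (A : Matrix (Fin m) (Fin n) ℝ) (b : Fin m → ℝ)
    (hα : 0 < α) (hf : StrongConvexOn univ α f) :
    ∃ α β, StronglyConvexProblem univ f (linCon A b) α β := by
  refine ⟨α, ‖conMap A‖ + 1, hα, hf, by positivity, fun k x _ y _ => ?_⟩
  calc |linCon A b k y - linCon A b k x| = ‖conMap A (y - x) k‖ := by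
        rw [← conVec_linCon_sub A b]
        rfl
    _ ≤ ‖conMap A (y - x)‖ := PiLp.norm_apply_le _ k
    _ ≤ ‖conMap A‖ * ‖y - x‖ := (conMap A).le_opNorm _
    _ ≤ (‖conMap A‖ + 1) * ‖y - x‖ := by
      gcongr
      exact le_add_of_nonneg_right zero_le_one

theorem dualAttained_linCon (A : Matrix (Fin m) (Fin n) ℝ) (b : Fin m → ℝ) (hα : 0 < α)
    (hf : StrongConvexOn univ α f) : DualAttained univ f (linCon A b) :=
  dualAttained_of_strongConvexOn hα hf (convexOn_linCon A b) isClosed_univ univ_nonempty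
    (hf.strictConvexOn hα).convexOn.locallyLipschitz.continuous.continuousOn
    fun k => (continuous_linCon A b k).continuousOn

theorem le_of_mul_self_le_mul {a c : ℝ} (hc : 0 ≤ c) (h : a * a ≤ a * c) : a ≤ c :=
  le_of_not_gt fun hlt => h.not_gt (mul_lt_mul_of_pos_left hlt (hc.trans_lt hlt))

namespace IsLagrangianMin

theorem norm_sub_le (hα : 0 < α) (hf : StrongConvexOn univ α f) (hlam : lam ∈ orthant m)
    (hmu : mu ∈ orthant m) (hx : IsLagrangianMin univ f (linCon A b) lam x)
    (hy : IsLagrangianMin univ f (linCon A b) mu y) :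
    ‖x - y‖ ≤ ‖conMap A‖ / α * ‖lam - mu‖ := by
  have hxy := hx.dual_add_sq_le hf (convexOn_linCon A b) hmu hy
  have hyx := hy.dual_add_sq_le hf (convexOn_linCon A b) hlam hx
  have hmono : α * ‖x - y‖ ^ 2 ≤ ⟪conMap A (x - y), mu - lam⟫ := by
    rw [norm_sub_rev y x, ← neg_sub mu lam, inner_neg_right] at hyx
    rw [← conVec_linCon_sub A b, inner_sub_left]
    linarith
  rw [div_mul_eq_mul_div, le_div_iff₀' hα]
  refine le_of_mul_self_le_mul (by positivity) ?_
  calc α * ‖x - y‖ * (α * ‖x - y‖) = α * (α * ‖x - y‖ ^ 2) := by ring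
    _ ≤ α * (‖conMap A (x - y)‖ * ‖mu - lam‖) :=
      mul_le_mul_of_nonneg_left (hmono.trans (real_inner_le_norm _ _)) hα.le
    _ ≤ α * (‖conMap A‖ * ‖x - y‖ * ‖lam - mu‖) := by
      rw [norm_sub_rev mu lam]
      gcongr
      exact (conMap A).le_opNorm _
    _ = α * ‖x - y‖ * (‖conMap A‖ * ‖lam - mu‖) := by ring

theorem exists_forall_mem (hα : 0 < α) (hf : StrongConvexOn univ α f) (hlams : lams ∈ orthant m)
    (hs : IsLagrangianMin univ f (linCon A b) lams xs) {U : Set (E n)} (hU : U ∈ 𝓝 xs) :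
    ∃ D > 0, ∀ lam ∈ orthant m, ‖lam - lams‖ ≤ D →
      ∀ x, IsLagrangianMin univ f (linCon A b) lam x → x ∈ U := by
  obtain ⟨r, hr, hrU⟩ := Metric.nhds_basis_closedBall.mem_iff.1 hU
  refine ⟨r / (‖conMap A‖ / α + 1), by positivity, fun lam hlam hD x hx => hrU ?_⟩
  rw [mem_closedBall_iff_norm]
  calc ‖x - xs‖ ≤ ‖conMap A‖ / α * ‖lam - lams‖ := hx.norm_sub_le hα hf hlam hlams hs
    _ ≤ (‖conMap A‖ / α + 1) * ‖lam - lams‖ := by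
      gcongr
      exact le_add_of_nonneg_right zero_le_one
    _ ≤ r := (le_div_iff₀' (by positivity)).1 hD

end IsLagrangianMin

/-! ### Stationarity -/

theorem hasFDerivAt_lagrangian_linCon (hd : DifferentiableAt ℝ f x) (lam : E m) :
    HasFDerivAt (lagrangian f (linCon A b) lam)
      (fderiv ℝ f x + (innerSL ℝ lam).comp (conMap A)) x := by
  have hlin : lagrangian f (linCon A b) lam = fun z =>
      f z + ((innerSL ℝ lam).comp (conMap A) z - ⟪lam, WithLp.toLp 2 b⟫) := by
    funext z
    rw [lagrangian_eq_add_inner, ContinuousLinearMap.comp_apply, innerSL_apply_apply,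
      ← inner_sub_right]
    rfl
  rw [hlin]
  exact hd.hasFDerivAt.add (((innerSL ℝ lam).comp (conMap A)).hasFDerivAt.sub_const _)

theorem IsLagrangianMin.fderiv_apply (hx : IsLagrangianMin univ f (linCon A b) lam x)
    (hd : DifferentiableAt ℝ f x) (v : E n) : fderiv ℝ f x v = -⟪lam, conMap A v⟫ := by
  have hzero := IsLocalMin.hasFDerivAt_eq_zero (hx.2.isLocalMin univ_mem)
    (hasFDerivAt_lagrangian_linCon hd lam)
  exact eq_neg_of_add_eq_zero_left (DFunLike.congr_fun hzero v)

theorem add_fderiv_le_of_convexOn {F : Type*} [NormedAddCommGroup F] [NormedSpace ℝ F]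
    {h : F → ℝ} {h' : F →L[ℝ] ℝ} {x : F} (hc : ConvexOn ℝ univ h) (hh : HasFDerivAt h h' x)
    (y : F) : h x + h' (y - x) ≤ h y := by
  have hline : HasDerivAt (h ∘ AffineMap.lineMap (k := ℝ) x y) (h' (y - x)) 0 :=
    HasFDerivAt.comp_hasDerivAt (0 : ℝ) (by simpa using hh) AffineMap.hasDerivAt_lineMap
  have hslope := (hc.comp_affineMap (AffineMap.lineMap (k := ℝ) x y)).le_slope_of_hasDerivAt
    (mem_univ 0) (mem_univ 1) one_pos hline
  rw [slope_def_field] at hslope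
  simp only [Function.comp_apply, AffineMap.lineMap_apply_one, AffineMap.lineMap_apply_zero,
    sub_zero, div_one] at hslope
  linarith

theorem isLagrangianMin_of_fderiv_apply (hf : ConvexOn ℝ univ f) (hd : DifferentiableAt ℝ f x)
    (h : ∀ v, fderiv ℝ f x v = -⟪lam, conMap A v⟫) :
    IsLagrangianMin univ f (linCon A b) lam x :=
  ⟨mem_univ x, isMinOn_iff.2 fun y _ => by
    have hle := add_fderiv_le_of_convexOn hf hd.hasFDerivAt y
    have hlin := conVec_linCon_sub A b y x
    rw [h, ← hlin, inner_sub_right] at hle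
    rw [lagrangian_eq_add_inner, lagrangian_eq_add_inner]
    linarith⟩

/-! ### Independent rows and strong duality -/

/-- `R` is a right inverse of the rows of `A` with index in `S`. -/
def IsRowInverse (A : Matrix (Fin m) (Fin n) ℝ) (S : Set (Fin m)) (R : E m →L[ℝ] E n) : Prop :=
  ∀ w, ∀ k ∈ S, conMap A (R w) k = w k

theorem exists_isRowInverse_range {ι : Type*} [Finite ι] (e : ι → Fin m)
    (hA : (A.submatrix e id).rank = Nat.card ι) : ∃ R, IsRowInverse A (range e) R := by
  have := Fintype.ofFinite ι
  have hrange : (A.submatrix e id).mulVecLin.range = ⊤ := by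
    apply Submodule.eq_top_of_finrank_eq
    rw [Module.finrank_fintype_fun_eq_card, ← Nat.card_eq_fintype_card]
    exact hA
  obtain ⟨r, hr⟩ := LinearMap.exists_rightInverse_of_surjective _ hrange
  let R : E m →ₗ[ℝ] E n := (WithLp.linearEquiv 2 ℝ (Fin n → ℝ)).symm.toLinearMap ∘ₗ r ∘ₗ
    LinearMap.funLeft ℝ ℝ e ∘ₗ (WithLp.linearEquiv 2 ℝ (Fin m → ℝ)).toLinearMap
  refine ⟨R.toContinuousLinearMap, fun w => forall_mem_range.2 fun i => ?_⟩
  exact congrFun (DFunLike.congr_fun hr fun j => w (e j)) i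

theorem exists_isRowInverse_univ (hA : A.rank = m) : ∃ R, IsRowInverse A univ R := by
  rw [← range_id]
  exact exists_isRowInverse_range id (by rwa [Matrix.submatrix_id_id, Nat.card_fin])

theorem exists_isRowInverse_activeSet
    (hA : (activeSubmatrix A b x).rank = Nat.card (activeSet A b x)) :
    ∃ R, IsRowInverse A (activeSet A b x) R := by
  simpa only [Subtype.range_coe] using
    exists_isRowInverse_range ((↑) : activeSet A b x → Fin m) hA

theorem IsRowInverse.mono {S T : Set (Fin m)} {R : E m →L[ℝ] E n} (hR : IsRowInverse A T R)
    (hST : S ⊆ T) : IsRowInverse A S R :=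
  fun w k hk => hR w k (hST hk)

/-- The orthogonal projection onto the coordinates in `S`. -/
noncomputable def coordProj (S : Set (Fin m)) (v : E m) : E m :=
  WithLp.toLp 2 (S.indicator v)

theorem coordProj_of_mem {S : Set (Fin m)} {k : Fin m} (hk : k ∈ S) (v : E m) :
    coordProj S v k = v k :=
  indicator_of_mem hk _

theorem coordProj_of_notMem {S : Set (Fin m)} {k : Fin m} (hk : k ∉ S) (v : E m) :
    coordProj S v k = 0 :=
  indicator_of_notMem hk _

theorem inner_coordProj_left (S : Set (Fin m)) (u v : E m) :
    ⟪coordProj S u, v⟫ = ⟪u, coordProj S v⟫ := by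
  rw [inner_eq_sum, inner_eq_sum]
  refine Finset.sum_congr rfl fun k _ => ?_
  by_cases hk : k ∈ S
  · rw [coordProj_of_mem hk, coordProj_of_mem hk]
  · rw [coordProj_of_notMem hk, coordProj_of_notMem hk, zero_mul, mul_zero]

theorem linCon_eq_zero_iff {k : Fin m} : linCon A b k x = 0 ↔ k ∈ activeSet A b x :=
  sub_eq_zero

theorem linCon_neg_of_notMem_activeSet (hx : x ∈ feasible univ (linCon A b)) {k : Fin m}
    (hk : k ∉ activeSet A b x) : linCon A b k x < 0 :=
  (hx.2 k).lt_of_ne fun h => hk (linCon_eq_zero_iff.1 h)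

theorem mem_posTangentConeAt_feasible (hxs : xs ∈ feasible univ (linCon A b)) {v : E n}
    (hv : ∀ k ∈ activeSet A b xs, conMap A v k ≤ 0) :
    v ∈ posTangentConeAt (feasible univ (linCon A b)) xs := by
  refine mem_posTangentConeAt_of_frequently_mem (Eventually.frequently ?_)
  suffices h : ∀ᶠ t : ℝ in 𝓝[>] 0, ∀ k, linCon A b k (xs + t • v) ≤ 0 from
    h.mono fun t ht => ⟨mem_univ _, ht⟩
  refine eventually_all.2 fun k => ?_
  by_cases hk : k ∈ activeSet A b xs
  · filter_upwards [self_mem_nhdsWithin] with t ht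
    rw [linCon_add, map_smul, linCon_eq_zero_iff.2 hk, zero_add]
    exact mul_nonpos_of_nonneg_of_nonpos (le_of_lt ht) (hv k hk)
  · have hlim : Tendsto (fun t : ℝ => linCon A b k (xs + t • v)) (𝓝[>] 0)
        (𝓝 (linCon A b k (xs + (0 : ℝ) • v))) :=
      (((continuous_linCon A b k).comp (by fun_prop : Continuous fun t : ℝ => xs + t • v)).tendsto
        0).mono_left nhdsWithin_le_nhds
    rw [zero_smul, add_zero] at hlim
    exact (hlim.eventually_lt_const (linCon_neg_of_notMem_activeSet hxs hk)).mono fun t ht => ht.le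

theorem fderiv_nonneg_of_isOptimal (hxs : IsOptimal univ f (linCon A b) xs)
    (hd : DifferentiableAt ℝ f xs) {v : E n} (hv : ∀ k ∈ activeSet A b xs, conMap A v k ≤ 0) :
    0 ≤ fderiv ℝ f xs v :=
  hxs.2.localize.hasFDerivWithinAt_nonneg hd.hasFDerivAt.hasFDerivWithinAt
    (mem_posTangentConeAt_feasible hxs.1 hv)

theorem fderiv_eq_zero_of_isOptimal (hxs : IsOptimal univ f (linCon A b) xs)
    (hd : DifferentiableAt ℝ f xs) {v : E n} (hv : ∀ k ∈ activeSet A b xs, conMap A v k = 0) :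
    fderiv ℝ f xs v = 0 := by
  have hpos := fderiv_nonneg_of_isOptimal hxs hd fun k hk => (hv k hk).le
  have hneg := fderiv_nonneg_of_isOptimal hxs hd (v := -v) fun k hk => by
    rw [map_neg, PiLp.neg_apply, hv k hk, neg_zero]
  rw [map_neg] at hneg
  linarith

theorem exists_kkt_multiplier (hxs : IsOptimal univ f (linCon A b) xs)
    (hd : DifferentiableAt ℝ f xs) {R : E m →L[ℝ] E n}
    (hR : IsRowInverse A (activeSet A b xs) R) :
    ∃ lams ∈ orthant m, (∀ k, lams k * linCon A b k xs = 0) ∧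
      ∀ v, fderiv ℝ f xs v = -⟪lams, conMap A v⟫ := by
  set p : E m := -(InnerProductSpace.toDual ℝ (E m)).symm ((fderiv ℝ f xs).comp R)
  have hp (w : E m) : ⟪p, w⟫ = -fderiv ℝ f xs (R w) := by
    rw [inner_neg_left, InnerProductSpace.toDual_symm_apply, ContinuousLinearMap.comp_apply]
  refine ⟨coordProj (activeSet A b xs) p, fun k => ?_, fun k => ?_, fun v => ?_⟩
  · by_cases hk : k ∈ activeSet A b xs
    · have hcoord : p k = fderiv ℝ f xs (-R (EuclideanSpace.single k 1)) := by
        rw [map_neg, ← hp, EuclideanSpace.inner_single_right]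
        simp
      rw [coordProj_of_mem hk, hcoord]
      refine fderiv_nonneg_of_isOptimal hxs hd fun j hj => ?_
      rw [map_neg, PiLp.neg_apply, hR _ j hj, PiLp.single_apply]
      split_ifs <;> norm_num
    · exact (coordProj_of_notMem hk p).ge
  · by_cases hk : k ∈ activeSet A b xs
    · rw [linCon_eq_zero_iff.2 hk, mul_zero]
    · rw [coordProj_of_notMem hk, zero_mul]
  · have hker := fderiv_eq_zero_of_isOptimal hxs hd
      (v := v - R (coordProj (activeSet A b xs) (conMap A v))) fun k hk => by
        rw [map_sub, PiLp.sub_apply, hR _ k hk, coordProj_of_mem hk, sub_self]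
    rw [map_sub, sub_eq_zero] at hker
    rw [hker, inner_coordProj_left, hp, neg_neg]

theorem strongDuality_of_isRowInverse (hxs : IsOptimal univ f (linCon A b) xs)
    (hf : ConvexOn ℝ univ f) (hd : DifferentiableAt ℝ f xs) {R : E m →L[ℝ] E n}
    (hR : IsRowInverse A (activeSet A b xs) R) : StrongDuality univ f (linCon A b) := by
  obtain ⟨lams, hlams, hslack, hstat⟩ := exists_kkt_multiplier hxs hd hR
  exact ⟨lams, isLagrangeMultiplier_of_isLagrangianMin hxs hlams
    (isLagrangianMin_of_fderiv_apply hf hd hstat) hslack⟩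

/-! ### Curvature of the dual function -/

theorem coordProj_add_coordProj_compl (S : Set (Fin m)) (v : E m) :
    coordProj S v + coordProj Sᶜ v = v := by
  ext k
  exact congrFun (indicator_self_add_compl S v.ofLp) k

theorem norm_sq_coordProj_add (S : Set (Fin m)) (v : E m) :
    ‖coordProj S v‖ ^ 2 + ‖coordProj Sᶜ v‖ ^ 2 = ‖v‖ ^ 2 := by
  have horth : ⟪coordProj S v, coordProj Sᶜ v⟫ = 0 := by
    rw [inner_eq_sum]
    refine Finset.sum_eq_zero fun k _ => ?_
    by_cases hk : k ∈ S
    · rw [coordProj_of_notMem (notMem_compl_iff.2 hk), mul_zero]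
    · rw [coordProj_of_notMem hk, zero_mul]
  have hpyth := norm_add_sq_eq_norm_sq_add_norm_sq_real horth
  rw [coordProj_add_coordProj_compl] at hpyth
  rw [sq, sq, sq, hpyth]

theorem coordProj_univ (v : E m) : coordProj univ v = v := by
  ext k
  exact coordProj_of_mem (mem_univ k) v

theorem coordProj_empty (v : E m) : coordProj ∅ v = 0 := by
  ext k
  exact coordProj_of_notMem (notMem_empty k) v

theorem IsRowInverse.inner_coordProj {S : Set (Fin m)} {R : E m →L[ℝ] E n}
    (hR : IsRowInverse A S R) (v w : E m) :
    ⟪coordProj S v, conMap A (R w)⟫ = ⟪coordProj S v, w⟫ := by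
  have hproj : coordProj S (conMap A (R w)) = coordProj S w := by
    ext k
    by_cases hk : k ∈ S
    · rw [coordProj_of_mem hk, coordProj_of_mem hk, hR w k hk]
    · rw [coordProj_of_notMem hk, coordProj_of_notMem hk]
  rw [inner_coordProj_left, hproj, inner_coordProj_left]

namespace IsLagrangianMin

theorem norm_coordProj_sub_le (hx : IsLagrangianMin univ f (linCon A b) lam x)
    (hy : IsLagrangianMin univ f (linCon A b) mu y) (hdx : DifferentiableAt ℝ f x)
    (hdy : DifferentiableAt ℝ f y) {S : Set (Fin m)} {R : E m →L[ℝ] E n}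
    (hR : IsRowInverse A S R) :
    ‖coordProj S (lam - mu)‖ ≤ ‖R‖ * (‖fderiv ℝ f x - fderiv ℝ f y‖ +
      ‖conMap A‖ * ‖coordProj Sᶜ (lam - mu)‖) := by
  set w := coordProj S (lam - mu)
  set u := coordProj Sᶜ (lam - mu)
  have hstat : (fderiv ℝ f y - fderiv ℝ f x) (R w) = ‖w‖ ^ 2 + ⟪u, conMap A (R w)⟫ := calc
    (fderiv ℝ f y - fderiv ℝ f x) (R w) = ⟪lam - mu, conMap A (R w)⟫ := by
      rw [sub_apply, hx.fderiv_apply hdx, hy.fderiv_apply hdy, inner_sub_left]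
      ring
    _ = ⟪w, conMap A (R w)⟫ + ⟪u, conMap A (R w)⟫ := by
      rw [← inner_add_left, coordProj_add_coordProj_compl]
    _ = ‖w‖ ^ 2 + ⟪u, conMap A (R w)⟫ := by
      rw [hR.inner_coordProj, real_inner_self_eq_norm_sq]
  have hderiv : (fderiv ℝ f y - fderiv ℝ f x) (R w) ≤ ‖fderiv ℝ f x - fderiv ℝ f y‖ * ‖R w‖ :=
    norm_sub_rev (fderiv ℝ f y) _ ▸ (le_abs_self _).trans ((_ : E n →L[ℝ] ℝ).le_opNorm _)
  have hinner : -⟪u, conMap A (R w)⟫ ≤ ‖u‖ * (‖conMap A‖ * ‖R w‖) := calc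
    -⟪u, conMap A (R w)⟫ ≤ ‖u‖ * ‖conMap A (R w)‖ :=
      (neg_le_abs _).trans (abs_real_inner_le_norm _ _)
    _ ≤ ‖u‖ * (‖conMap A‖ * ‖R w‖) := by
      gcongr
      exact (conMap A).le_opNorm _
  refine le_of_mul_self_le_mul (by positivity) ?_
  calc ‖w‖ * ‖w‖ ≤ ‖R w‖ * (‖fderiv ℝ f x - fderiv ℝ f y‖ + ‖conMap A‖ * ‖u‖) := by
        linarith
    _ ≤ ‖R‖ * ‖w‖ * (‖fderiv ℝ f x - fderiv ℝ f y‖ + ‖conMap A‖ * ‖u‖) := by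
      gcongr
      exact R.le_opNorm w
    _ = ‖w‖ * (‖R‖ * (‖fderiv ℝ f x - fderiv ℝ f y‖ + ‖conMap A‖ * ‖u‖)) := by ring

theorem norm_sub_le_norm_fderiv_sub (hx : IsLagrangianMin univ f (linCon A b) lam x)
    (hy : IsLagrangianMin univ f (linCon A b) mu y) (hdx : DifferentiableAt ℝ f x)
    (hdy : DifferentiableAt ℝ f y) {R : E m →L[ℝ] E n} (hR : IsRowInverse A univ R) :
    ‖lam - mu‖ ≤ ‖R‖ * ‖fderiv ℝ f x - fderiv ℝ f y‖ := by
  simpa only [coordProj_univ, compl_univ, coordProj_empty, norm_zero, mul_zero, add_zero] using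
    hx.norm_coordProj_sub_le hy hdx hdy hR

end IsLagrangianMin

/-- `h` is of class `C^{1,1}` near `a`: differentiable with Lipschitz derivative on a
neighbourhood of `a`. -/
def HasLipschitzFDerivNear (h : E n → ℝ) (a : E n) : Prop :=
  ∃ K, ∃ U ∈ 𝓝 a, (∀ x ∈ U, DifferentiableAt ℝ h x) ∧ LipschitzOnWith K (fderiv ℝ h) U

theorem HasLipschitzFDerivNear.differentiableAt (hf : HasLipschitzFDerivNear f x) :
    DifferentiableAt ℝ f x :=
  let ⟨_, _, hU, hd, _⟩ := hf
  hd x (mem_of_mem_nhds hU)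

theorem hasLipschitzFDerivNear_of_contDiff (hf : ContDiff ℝ 2 f) (x : E n) :
    HasLipschitzFDerivNear f x := by
  obtain ⟨K, U, hU, hK⟩ :=
    ((hf.fderiv_right (m := 1) (by norm_num)).contDiffAt (x := x)).exists_lipschitzOnWith
  exact ⟨K, U, hU, fun y _ => hf.differentiable two_ne_zero y, hK⟩

theorem convex_orthant_inter_ball (lams : E m) (D : ℝ) :
    Convex ℝ {lam | lam ∈ orthant m ∧ ‖lam - lams‖ ≤ D} := by
  convert (convex_orthant m).inter (convex_closedBall lams D) using 1
  ext lam
  exact and_congr_right fun _ => mem_closedBall_iff_norm.symm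

theorem exists_locallyStronglyConcaveDualAt (hα : 0 < α) (hf : StrongConvexOn univ α f)
    (hlip : HasLipschitzFDerivNear f xs) (hlams : lams ∈ orthant m)
    (hs : IsLagrangianMin univ f (linCon A b) lams xs) {R : E m →L[ℝ] E n}
    (hR : IsRowInverse A univ R) :
    ∃ D L, LocallyStronglyConcaveDualAt univ f (linCon A b) lams D L := by
  obtain ⟨K, U, hU, hd, hK⟩ := hlip
  obtain ⟨D, hD, hmem⟩ := hs.exists_forall_mem hα hf hlams hU
  have hatt := dualAttained_linCon A b hα hf
  have hcon := convexOn_linCon A b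
  set P : ℝ := ‖R‖ * K + 1
  have hP : 0 < P := by positivity
  refine ⟨D, α / P ^ 2, hD, by positivity, strongConcaveOn_of_supergradient
    (G := dualGradient univ f (linCon A b)) (convex_orthant_inter_ball lams D)
    fun lam hlam mu hmu => ?_⟩
  obtain ⟨x, hx⟩ := hatt.exists_isLagrangianMin hlam.1
  obtain ⟨y, hy⟩ := hatt.exists_isLagrangianMin hmu.1
  have hxU := hmem lam hlam.1 hlam.2 x hx
  have hyU := hmem mu hmu.1 hmu.2 y hy
  have hdist : ‖mu - lam‖ ≤ P * ‖x - y‖ := calc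
    ‖mu - lam‖ ≤ ‖R‖ * ‖fderiv ℝ f x - fderiv ℝ f y‖ := norm_sub_rev mu lam ▸
      hx.norm_sub_le_norm_fderiv_sub hy (hd x hxU) (hd y hyU) hR
    _ ≤ ‖R‖ * (K * ‖x - y‖) := by
      gcongr
      exact hK.norm_sub_le hxU hyU
    _ ≤ P * ‖x - y‖ := by linarith [norm_nonneg (x - y)]
  rw [hx.dualGradient_eq hα hf hcon hlam.1]
  refine le_trans ?_ (hx.dual_add_sq_le hf hcon hmu.1 hy)
  refine add_le_add_right ?_ _
  calc α / P ^ 2 / 2 * ‖mu - lam‖ ^ 2 ≤ α / P ^ 2 / 2 * (P * ‖x - y‖) ^ 2 := by gcongr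
    _ = α / 2 * ‖x - y‖ ^ 2 := by
      rw [mul_pow]
      field_simp

theorem exists_pos_forall_le_neg {ι : Type*} [Finite ι] (u : ι → ℝ) :
    ∃ δ > 0, ∀ k, u k < 0 → u k ≤ -δ := by
  have hδ : ∀ᶠ δ : ℝ in 𝓝[>] 0, ∀ k, u k < 0 → u k ≤ -δ := by
    refine eventually_all.2 fun k => ?_
    by_cases hk : u k < 0
    · filter_upwards [Ioo_mem_nhdsGT (neg_pos.2 hk)] with δ hδ _
      exact le_neg_of_le_neg hδ.2.le
    · exact Eventually.of_forall fun _ h => absurd h hk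
  exact (eventually_mem_nhdsWithin.and hδ).exists

theorem IsLagrangeMultiplier.inner_conVec_sub_le {X : Set (E n)} {g : Fin m → E n → ℝ}
    (h : IsLagrangeMultiplier X f g lams) (hxs : IsOptimal X f g xs) (hatt : DualAttained X f g)
    {S : Set (Fin m)} {δ : ℝ} (hδ : 0 < δ) (hS : ∀ k ∉ S, g k xs ≤ -δ) (hlam : lam ∈ orthant m)
    (hdist : ‖lam - lams‖ ≤ 1) :
    ⟪conVec g xs, lam - lams⟫ ≤ -δ * ‖coordProj Sᶜ (lam - lams)‖ ^ 2 := by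
  rw [inner_sub_right, real_inner_comm lams, h.inner_conVec_eq_zero hxs hatt, sub_zero,
    inner_eq_sum, EuclideanSpace.real_norm_sq_eq, Finset.mul_sum]
  refine Finset.sum_le_sum fun k _ => ?_
  by_cases hk : k ∈ S
  · rw [coordProj_of_notMem (notMem_compl_iff.2 hk), zero_pow two_ne_zero, mul_zero]
    exact mul_nonpos_of_nonpos_of_nonneg (hxs.1.2 k) (hlam k)
  · have hzero : lams k = 0 :=
      h.apply_eq_zero hxs hatt ((hS k hk).trans_lt (neg_neg_of_pos hδ)).ne
    have hone : lam k ≤ 1 := by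
      have hcoord := (le_abs_self _).trans ((PiLp.norm_apply_le (lam - lams) k).trans hdist)
      rwa [PiLp.sub_apply, hzero, sub_zero] at hcoord
    rw [coordProj_of_mem (mem_compl hk), PiLp.sub_apply, hzero, sub_zero]
    calc g k xs * lam k ≤ -δ * lam k := mul_le_mul_of_nonneg_right (hS k hk) (hlam k)
      _ ≤ -δ * lam k ^ 2 := mul_le_mul_of_nonpos_left
        (pow_le_of_le_one (hlam k) hone two_ne_zero) (neg_nonpos.2 hδ.le)

theorem min_div_mul_sq_add_sq_le {a δ P M r u w : ℝ} (ha : 0 ≤ a) (hδ : 0 ≤ δ) (hw : 0 ≤ w)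
    (h : w ≤ P * r + M * u) :
    min a δ / (2 * P ^ 2 + 2 * M ^ 2 + 1) * (w ^ 2 + u ^ 2) ≤ a * r ^ 2 + δ * u ^ 2 := by
  have hsq : w ^ 2 ≤ 2 * P ^ 2 * r ^ 2 + 2 * M ^ 2 * u ^ 2 := by
    linarith [pow_le_pow_left₀ hw h 2, sq_nonneg (P * r - M * u)]
  have hsum : w ^ 2 + u ^ 2 ≤ (2 * P ^ 2 + 2 * M ^ 2 + 1) * (r ^ 2 + u ^ 2) := by
    linarith [mul_nonneg (sq_nonneg M) (sq_nonneg r), mul_nonneg (sq_nonneg P) (sq_nonneg u),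
      sq_nonneg r]
  calc min a δ / (2 * P ^ 2 + 2 * M ^ 2 + 1) * (w ^ 2 + u ^ 2)
      ≤ min a δ / (2 * P ^ 2 + 2 * M ^ 2 + 1) *
          ((2 * P ^ 2 + 2 * M ^ 2 + 1) * (r ^ 2 + u ^ 2)) := by
        gcongr
    _ = min a δ * r ^ 2 + min a δ * u ^ 2 := by field_simp
    _ ≤ a * r ^ 2 + δ * u ^ 2 := by
      gcongr
      exacts [min_le_left _ _, min_le_right _ _]

theorem exists_locallyQuadraticDualAt (hxs : IsOptimal univ f (linCon A b) xs) (hα : 0 < α)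
    (hf : StrongConvexOn univ α f) (hlip : HasLipschitzFDerivNear f xs)
    (hlams : IsLagrangeMultiplier univ f (linCon A b) lams) {R : E m →L[ℝ] E n}
    (hR : IsRowInverse A (activeSet A b xs) R) :
    ∃ D L, LocallyQuadraticDualAt univ f (linCon A b) lams D L := by
  have hatt := dualAttained_linCon A b hα hf
  have hs := hlams.isLagrangianMin hxs hatt
  obtain ⟨K, U, hU, hd, hK⟩ := hlip
  obtain ⟨D, hD, hmem⟩ := hs.exists_forall_mem hα hf hlams.1 hU
  obtain ⟨δ, hδ, hslack⟩ := exists_pos_forall_le_neg fun k => linCon A b k xs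
  refine ⟨min D 1, min (α / 2) δ / (2 * (‖R‖ * K) ^ 2 + 2 * (‖R‖ * ‖conMap A‖) ^ 2 + 1),
    lt_min hD one_pos, by positivity, fun lam hlam hdist => ?_⟩
  obtain ⟨x, hx⟩ := hatt.exists_isLagrangianMin hlam
  have hxU := hmem lam hlam (hdist.trans (min_le_left _ _)) x hx
  have hxsU := mem_of_mem_nhds hU
  have hdual := hs.dual_add_sq_le hf (convexOn_linCon A b) hlam hx
  have hinner := hlams.inner_conVec_sub_le hxs hatt hδ
    (fun k hk => hslack k (linCon_neg_of_notMem_activeSet hxs.1 hk)) hlam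
    (hdist.trans (min_le_right _ _))
  have hactive : ‖coordProj (activeSet A b xs) (lam - lams)‖ ≤ ‖R‖ * K * ‖x - xs‖ +
      ‖R‖ * ‖conMap A‖ * ‖coordProj (activeSet A b xs)ᶜ (lam - lams)‖ := calc
    _ ≤ _ := hx.norm_coordProj_sub_le hs (hd x hxU) (hd xs hxsU) hR
    _ ≤ ‖R‖ * (K * ‖x - xs‖ + ‖conMap A‖ * ‖coordProj (activeSet A b xs)ᶜ (lam - lams)‖) := by
      gcongr
      exact hK.norm_sub_le hxU hxsU
    _ = _ := by ring
  have hcurv := min_div_mul_sq_add_sq_le (half_pos hα).le hδ.le (norm_nonneg _) hactive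
  rw [norm_sq_coordProj_add] at hcurv
  rw [norm_sub_rev xs x] at hdual
  linarith

end LinearConstraints

end DPP

open DPP Set in
theorem mainTheorem7_general {m n : ℕ} (hm : 0 < m) (f : E n → ℝ)
    (A : Matrix (Fin m) (Fin n) ℝ) (b : Fin m → ℝ)
    (hfc : ∃ α : ℝ, 0 < α ∧ StrongConvexOn univ α f) (xs : E n)
    (hlip : HasLipschitzFDerivNear f xs) (hxs : IsOptimal univ f (linCon A b) xs) :
    DualAttained univ f (linCon A b) ∧
    RunsExist univ f (linCon A b) ∧
    ((activeSubmatrix A b xs).rank = Nat.card (activeSet A b xs) →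
      (∃ α β, StronglyConvexProblem univ f (linCon A b) α β) ∧
      StrongDuality univ f (linCon A b) ∧
      (∃ γ, SmoothDual univ f (linCon A b) γ) ∧
      (∀ lams, IsLagrangeMultiplier univ f (linCon A b) lams →
        ∃ D L, LocallyQuadraticDualAt univ f (linCon A b) lams D L) ∧
      ∀ α β V : ℝ, StronglyConvexProblem univ f (linCon A b) α β → m * β ^ 2 / α ≤ V →
        ∀ x Q xbar, IsRun univ f (linCon A b) V x Q xbar →
          HasGeometricRate f (linCon A b) xs x ∧ HasGeometricRate f (linCon A b) xs xbar) ∧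
    (A.rank = m →
      (∃ α β, StronglyConvexProblem univ f (linCon A b) α β) ∧
      StrongDuality univ f (linCon A b) ∧
      (∃ γ, SmoothDual univ f (linCon A b) γ) ∧
      (∀ lams, IsLagrangeMultiplier univ f (linCon A b) lams →
        ∃ D L, LocallyStronglyConcaveDualAt univ f (linCon A b) lams D L) ∧
      ∀ α β V : ℝ, StronglyConvexProblem univ f (linCon A b) α β → m * β ^ 2 / α ≤ V →
        ∀ x Q xbar, IsRun univ f (linCon A b) V x Q xbar →
          (∀ lams D L, IsLagrangeMultiplier univ f (linCon A b) lams →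
            LocallyStronglyConcaveDualAt univ f (linCon A b) lams D L →
            ErrorDecaysLike f (linCon A b) xs x
              (fun t => 1 / (t : ℝ) * (1 - L / V) ^ ((t : ℝ) / 4)) ∧
            ErrorDecaysLike f (linCon A b) xs xbar
              (fun t => 1 / (t : ℝ) * (1 - L / V) ^ ((t : ℝ) / 4))) ∧
          HasGeometricRate f (linCon A b) xs x ∧ HasGeometricRate f (linCon A b) xs xbar) := by
  obtain ⟨α₀, hα₀, hf⟩ := hfc
  have hg := convexOn_linCon A b
  have hatt := dualAttained_linCon A b hα₀ hf
  obtain ⟨α₁, β₁, hP⟩ := exists_stronglyConvexProblem_linCon A b hα₀ hf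
  have hsmooth := hP.exists_smoothDual hg hatt
  have hconv := (hf.strictConvexOn hα₀).convexOn
  refine ⟨hatt, hatt.runsExist, fun hrank => ?_, fun hrank => ?_⟩
  · obtain ⟨R, hR⟩ := exists_isRowInverse_activeSet hrank
    obtain ⟨lams, hlams⟩ := strongDuality_of_isRowInverse hxs hconv hlip.differentiableAt hR
    have hquad := fun lams hlams => exists_locallyQuadraticDualAt (lams := lams) hxs hα₀ hf hlip
      hlams hR
    obtain ⟨D, L, hq⟩ := hquad lams hlams
    exact ⟨⟨α₁, β₁, hP⟩, ⟨lams, hlams⟩, hsmooth, hquad, fun α β V hP' hV x Q xbar hrun =>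
      hrun.hasGeometricRate hP' hg hatt hV hxs hlams hq⟩
  · obtain ⟨R, hR⟩ := exists_isRowInverse_univ hrank
    obtain ⟨lams, hlams⟩ := strongDuality_of_isRowInverse hxs hconv hlip.differentiableAt
      (hR.mono (subset_univ _))
    have hcurv := fun lams (hlams : IsLagrangeMultiplier univ f (linCon A b) lams) =>
      exists_locallyStronglyConcaveDualAt hα₀ hf hlip hlams.1 (hlams.isLagrangianMin hxs hatt) hR
    obtain ⟨D, L, hq⟩ := hcurv lams hlams
    exact ⟨⟨α₁, β₁, hP⟩, ⟨lams, hlams⟩, hsmooth, hcurv, fun α β V hP' hV x Q xbar hrun =>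
      ⟨fun _ _ _ hmult hq' =>
        hrun.errorDecaysLike_one_div_mul_rpow hm hP' hg hatt hV hxs hmult hq',
      hrun.hasGeometricRate hP' hg hatt hV hxs hlams (hq.locallyQuadraticDualAt hlams hxs hatt)⟩⟩

theorem mainTheorem7 {m n : ℕ} (hm : 0 < m)
    (f : DPP.E n → ℝ) (A : Matrix (Fin m) (Fin n) ℝ) (b : Fin m → ℝ)
    (hf : ContDiff ℝ 2 f) (hfc : ∃ α : ℝ, 0 < α ∧ StrongConvexOn Set.univ α f)
    (xs : DPP.E n) (hxs : DPP.IsOptimal Set.univ f (DPP.linCon A b) xs) :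
    -- the dual function is well defined and the algorithm can be executed
    DPP.DualAttained Set.univ f (DPP.linCon A b) ∧
    DPP.RunsExist Set.univ f (DPP.linCon A b) ∧
    -- part 1: the active submatrix has full row rank
    ((DPP.activeSubmatrix A b xs).rank = Nat.card (DPP.activeSet A b xs) →
      (∃ α β, DPP.StronglyConvexProblem Set.univ f (DPP.linCon A b) α β) ∧
      DPP.StrongDuality Set.univ f (DPP.linCon A b) ∧
      (∃ γ, DPP.SmoothDual Set.univ f (DPP.linCon A b) γ) ∧
      (∀ lams, DPP.IsLagrangeMultiplier Set.univ f (DPP.linCon A b) lams →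
        ∃ D L, DPP.LocallyQuadraticDualAt Set.univ f (DPP.linCon A b) lams D L) ∧
      ∀ α β γ V : ℝ, DPP.StronglyConvexProblem Set.univ f (DPP.linCon A b) α β →
        DPP.SmoothDual Set.univ f (DPP.linCon A b) γ →
        max (m * β ^ 2 / α) γ ≤ V →
        ∀ x Q xbar, DPP.IsRun Set.univ f (DPP.linCon A b) V x Q xbar →
          DPP.ErrorDecaysLike f (DPP.linCon A b) xs xbar
            (fun t => 1 / (t : ℝ) ^ (3 / 2 : ℝ)) ∧
          DPP.HasConvergenceTime Set.univ f (DPP.linCon A b) xs xbar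
            (fun ε => 1 / ε ^ (2 / 3 : ℝ))) ∧
    -- part 2: `A` has full row rank
    (A.rank = m →
      (∃ α β, DPP.StronglyConvexProblem Set.univ f (DPP.linCon A b) α β) ∧
      DPP.StrongDuality Set.univ f (DPP.linCon A b) ∧
      (∃ γ, DPP.SmoothDual Set.univ f (DPP.linCon A b) γ) ∧
      (∀ lams, DPP.IsLagrangeMultiplier Set.univ f (DPP.linCon A b) lams →
        ∃ D L, DPP.LocallyStronglyConcaveDualAt Set.univ f (DPP.linCon A b) lams D L) ∧
      ∀ α β γ V : ℝ, DPP.StronglyConvexProblem Set.univ f (DPP.linCon A b) α β →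
        DPP.SmoothDual Set.univ f (DPP.linCon A b) γ →
        max (m * β ^ 2 / α) γ ≤ V →
        ∀ x Q xbar, DPP.IsRun Set.univ f (DPP.linCon A b) V x Q xbar →
          -- the iterates themselves (no running averages) and their shifted running averages
          (∀ lams D L, DPP.IsLagrangeMultiplier Set.univ f (DPP.linCon A b) lams →
            DPP.LocallyStronglyConcaveDualAt Set.univ f (DPP.linCon A b) lams D L →
            DPP.ErrorDecaysLike f (DPP.linCon A b) xs x
              (fun t => 1 / (t : ℝ) * (1 - L / V) ^ ((t : ℝ) / 4)) ∧
            DPP.ErrorDecaysLike f (DPP.linCon A b) xs xbar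
              (fun t => 1 / (t : ℝ) * (1 - L / V) ^ ((t : ℝ) / 4))) ∧
          DPP.HasConvergenceTime Set.univ f (DPP.linCon A b) xs x
            (fun ε => Real.log (1 / ε)) ∧
          DPP.HasConvergenceTime Set.univ f (DPP.linCon A b) xs xbar
            (fun ε => Real.log (1 / ε))) := by
  obtain ⟨hatt, hruns, hactive, hfull⟩ := mainTheorem7_general hm f A b hfc xs
    (DPP.hasLipschitzFDerivNear_of_contDiff hf xs) hxs
  refine ⟨hatt, hruns, fun hrank => ?_, fun hrank => ?_⟩
  · obtain ⟨hA1, hA2, hA3, hA4, hrate⟩ := hactive hrank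
    refine ⟨hA1, hA2, hA3, hA4, fun α β _ V hP _ hV x Q xbar hrun => ?_⟩
    have hxbar := (hrate α β V hP ((le_max_left _ _).trans hV) x Q xbar hrun).2
    exact ⟨hxbar.errorDecaysLike_rpow,
      hxbar.hasConvergenceTime_rpow (.of_forall fun _ => Set.mem_univ _)⟩
  · obtain ⟨hA1, hA2, hA3, hA5, hrate⟩ := hfull hrank
    refine ⟨hA1, hA2, hA3, hA5, fun α β _ V hP _ hV x Q xbar hrun => ?_⟩
    obtain ⟨hdecay, hx, hxbar⟩ := hrate α β V hP ((le_max_left _ _).trans hV) x Q xbar hrun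
    exact ⟨hdecay, hx.hasConvergenceTime_log (.of_forall fun _ => Set.mem_univ _),
      hxbar.hasConvergenceTime_log (.of_forall fun _ => Set.mem_univ _)⟩
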